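/- **Setting.** Let $l,m,n$ be natural numbers and let $F$ be a field of characteristic $0$ with commuting derivations $\partial=(\partial^1,\dots,\partial^m)^t$ that are linearly independent over $F$. Assume that $(F,\partial)$ is differentially closed: every finite system of differential equations and an inequation $q\neq0$ over $F$ that is solvable in a differential field extension is solvable in $F$. Let $C=\{a\in F:\partial^1a=\dots=\partial^ma=0\}$. For a system $\delta$ of $m$ commuting derivations put $GL^{\delta}(m,F)=\{g\in GL(m,F):\delta^i g^j_k=\delta^j g^i_k\ \text{for all } i,j,k\}$ (upper index: row), and let $\mathbf B=\{g^{-1}\partial: g\in GL^{\partial}(m,F)\}$. A differential polynomial $p$ over $C$ is evaluated at $\delta\in\mathbf B$ and a point $v$ by letting $\delta$ act as the derivations; write $p^\delta\langle v\rangle$. For a family $S=(S_\delta)_{\delta\in\mathbf B}$ of subsets of an affine space, $C\{S\}$ is the ring of differential polynomials over $C$ modulo those $p$ with $p^\delta\langle v\rangle=0$ for all $\delta\in\mathbf B$, $v\in S_\delta$, and $C\langle S\rangle$ is its total ring of fractions, with the induced derivations $\partial$. An element $f\in C\langle S\rangle$ is defined at $(\delta,v)$ if $f=r/s$ (in the sense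 $f\cdot s=r$) with $s^\delta\langle v\rangle$ invertible, and then $f^\delta\langle v\rangle=r^\delta\langle v\rangle/s^\delta\langle v\rangle$; the same definition is used for points with coordinates in a ring with derivations that contains $C$. Let $W=(W_\delta)_{\delta\in\mathbf B}$, where each $W_\delta\subseteq F^l$ is closed and irreducible in the $\delta$-differential Zariski topology (closed sets: zero sets of $\delta$-differential polynomials over $F$). Let $\tau$ be an algebraic representation of the groupoid on $W$: for $\delta\in\mathbf B$, $(h,g)\in GL(n,F)\times GL^\delta(m,F)$, $v\in W_\delta$ an element $\tau^\delta\langle h,g;v\rangle\in W_{g^{-1}\delta}$ is given, such that $\tau^\delta\langle 1,1;v\rangle=v$, $$\tau^{g^{-1}\delta}\langle h_1,g_1;\tau^\delta\langle h,g;v\rangle\rangle=\tau^\delta\langle hh_1,gg_1;v\rangle\qquad(h_1\in GL(n,F),\ g_1\in GL^{g^{-1}\delta}(m,F)),$$ and each component of $\tau$ is an everywhere defined differential rational function over $C$ in $(h,g,v)$ on the family $(GL(n,F)\times GL^\delta(m,F)\times W_\delta)_\delta$. Let $W_0=(W_{0\delta})_\delta$ with $W_{0\delta}\subseteq W_\delta$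 dense, and invariant: $\tau^\delta\langle h,g;v\rangle\in W_{0,g^{-1}\delta}$ for $v\in W_{0\delta}$. Let $P^\delta\langle v\rangle=(P_0^\delta\langle v\rangle,P_1^\delta\langle v\rangle)\in GL(n,F)\times GL^\delta(m,F)$, for $v\in W_{0\delta}$, be given such that $$P_0^{g^{-1}\delta}\langle\tau^\delta\langle h,g;v\rangle\rangle=h^{-1}P_0^\delta\langle v\rangle,\qquad P_1^{g^{-1}\delta}\langle\tau^\delta\langle h,g;v\rangle\rangle=g^{-1}P_1^\delta\langle v\rangle,$$ the entries of $P_0,P_1$ being values of elements of $C\langle W\rangle$ that are defined on $W_0$; these elements form matrices $P_0^\partial\langle\mathbf x\rangle,P_1^\partial\langle\mathbf x\rangle$ over $C\langle W\rangle$, where $\mathbf x$ is the vector of coordinate functions. Let $C\langle W_e;\partial\rangle^G=C\langle W\rangle^G$ be the set of the $f\in C\langle W\rangle$ with $f^{g^{-1}\delta}\langle\tau^\delta\langle h,g;v\rangle\rangle=f^\delta\langle v\rangle$ for all $\delta\in\mathbf B$, $(h,g)\in GL(n,F)\times GL^\delta(m,F)$, $v\in W_\delta$ for which both sides are defined. **Theorem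 2.4.** Under these hypotheses $C\langle W\rangle$ is a field, $P_1^\partial\langle\mathbf x\rangle$ is invertible over it, and the members of $\delta=P_1^\partial\langle\mathbf x\rangle^{-1}\partial$ commute. The set $C\langle W_e;\partial\rangle^G$ is closed under $\delta^1,\dots,\delta^m$; the element $\tau^\partial\langle P^\partial\langle\mathbf x\rangle;\mathbf x\rangle\in C\langle W\rangle^l$ is defined, and $C\langle W_e;\partial\rangle^G$ is the $\delta$-differential subfield of $C\langle W\rangle$ generated over $C$ by its components: $$C\langle W_e;\partial\rangle^G=C\langle\tau^\partial\langle P^\partial\langle\mathbf x\rangle;\mathbf x\rangle;\delta\rangle .$$ -/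

import Mathlib

open scoped Matrix MatrixGroups

universe u

noncomputable section

namespace DiffInv

/-! ### Systems of derivations, jets and differential polynomials -/

/-- The members of the system `D` commute with each other. -/
def Commuting {A : Type*} [CommRing A] {m : ℕ} (D : Fin m → Derivation ℤ A A) : Prop :=
  ∀ i j a, D i (D j a) = D j (D i a)

/-- The operator `(D 0) ^ (α 0) * (D 1) ^ (α 1) * ⋯` attached to a multi-index `α`. -/
def jetOp {A : Type*} [CommRing A] {m : ℕ} (D : Fin m → Derivation ℤ A A) (α : Fin m → ℕ) :
    Module.End ℤ A :=
  ((List.finRange m).map fun i => ((D i : A →ₗ[ℤ] A) : Module.End ℤ A) ^ α i).prod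

/-- Differential polynomials over `R` in the unknowns `x k`, `k : ι`, for `m` commuting
derivations: polynomials in the indeterminates `(k, α)`, which stand for the
derivatives `∂ ^ α (x k)`. -/
abbrev DPoly (R : Type*) [CommRing R] (m : ℕ) (ι : Type*) : Type _ :=
  MvPolynomial (ι × (Fin m → ℕ)) R

/-- The value at the point `z` of a differential polynomial, the derivations being
interpreted by the system `D`. -/
def evalD {R A : Type*} [CommRing R] [CommRing A] [Algebra R A] {m : ℕ} {ι : Type*}
    (D : Fin m → Derivation ℤ A A) (z : ι → A) : DPoly R m ι →ₐ[R] A :=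
  MvPolynomial.aeval fun kα : ι × (Fin m → ℕ) => jetOp D kα.2 (z kα.1)

/-- The formal `i`-th derivation of the ring of differential polynomials with constant
coefficients: it sends `∂ ^ α (x k)` to `∂ ^ (α + e i) (x k)` and kills the coefficients. -/
def formalD (R : Type*) [CommRing R] {m : ℕ} (ι : Type*) (i : Fin m) :
    Derivation R (DPoly R m ι) (DPoly R m ι) :=
  MvPolynomial.mkDerivation R fun kα : ι × (Fin m → ℕ) =>
    MvPolynomial.X (kα.1, kα.2 + Pi.single i 1)

/-- The system `M D`, where `D` is regarded as a column. -/
def combo {A : Type*} [CommRing A] {m : ℕ} (M : Matrix (Fin m) (Fin m) A)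
    (D : Fin m → Derivation ℤ A A) : Fin m → Derivation ℤ A A :=
  fun i => ∑ j, M i j • D j

/-! ### Differential fields -/

section Field

variable {F : Type u} [Field F] {m : ℕ}

/-- The field of constants of `(F, ∂)`. -/
def constants (d : Fin m → Derivation ℤ F F) : Subfield F where
  carrier := {a | ∀ i, d i a = 0}
  mul_mem' := by
    intro a b ha hb i
    simp [Derivation.leibniz, ha i, hb i]
  one_mem' := by intro i; simp
  add_mem' := by
    intro a b ha hb i
    simp [ha i, hb i]
  zero_mem' := by intro i; simp
  neg_mem' := by
    intro a ha i
    simp [ha i]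
  inv_mem' := by
    intro a ha i
    simp [Derivation.leibniz_inv, ha i]

/-- `(F, ∂)` is differentially closed: each finite system of differential equations
`p = 0`, `p ∈ E`, and an inequation `q ≠ 0` in finitely many unknowns over `F` that has a
solution in some differential field extension of `(F, ∂)` has a solution in `F`. -/
def IsDiffClosed (d : Fin m → Derivation ℤ F F) : Prop :=
  ∀ (k : ℕ) (E : Finset (DPoly F m (Fin k))) (q : DPoly F m (Fin k)),
    (∃ (L : Type u) (_ : Field L) (_ : Algebra F L) (D : Fin m → Derivation ℤ L L),
      Commuting D ∧ (∀ i a, D i (algebraMap F L a) = algebraMap F L (d i a)) ∧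
      ∃ z : Fin k → L, (∀ p ∈ E, evalD D z p = 0) ∧ evalD D z q ≠ 0) →
    ∃ z : Fin k → F, (∀ p ∈ E, evalD d z p = 0) ∧ evalD d z q ≠ 0

/-- The common zeros of a set of differential polynomials with coefficients in `F`. -/
def zeros (d : Fin m → Derivation ℤ F F) {ι : Type*} (E : Set (DPoly F m ι)) : Set (ι → F) :=
  {z | ∀ p ∈ E, evalD d z p = 0}

/-- The differential Zariski topology of `(F, ∂)`: the closed sets are the sets of
common zeros of differential polynomials with coefficients in `F`. -/
@[reducible]
def kolchin (d : Fin m → Derivation ℤ F F) (ι : Type*) : TopologicalSpace (ι → F) :=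
  TopologicalSpace.ofClosed (Set.range fun E : Set (DPoly F m ι) => zeros d E)
    ⟨Set.univ, by
      ext z
      simp only [zeros, Set.mem_ofPred_eq, Set.mem_empty_iff_false, iff_false, not_forall]
      exact ⟨1, Set.mem_univ _, by simp⟩⟩
    (by
      intro S hS
      refine ⟨{p | ∃ E, zeros d E ∈ S ∧ p ∈ E}, ?_⟩
      ext z
      simp only [zeros, Set.mem_ofPred_eq, Set.mem_sInter]
      constructor
      · intro h Z hZ
        obtain ⟨E, rfl⟩ := hS hZ
        exact fun p hp => h p ⟨E, hZ, hp⟩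
      · rintro h p ⟨E, hE, hp⟩
        exact h _ hE p hp)
    (by
      rintro _ ⟨E, rfl⟩ _ ⟨E₂, rfl⟩
      refine ⟨{r | ∃ p ∈ E, ∃ q ∈ E₂, r = p * q}, ?_⟩
      ext z
      simp only [zeros, Set.mem_ofPred_eq, Set.mem_union]
      constructor
      · intro h
        by_contra! hc
        obtain ⟨⟨p, hp, hpz⟩, q, hq, hqz⟩ := hc
        have := h _ ⟨p, hp, q, hq, rfl⟩
        rw [map_mul] at this
        exact (mul_ne_zero hpz hqz) this
      · rintro (h | h) _ ⟨p, hp, q, hq, rfl⟩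
        · rw [map_mul, h p hp, zero_mul]
        · rw [map_mul, h q hq, mul_zero])

/-- `GL^∂(m, F)`: the invertible matrices `g` (first index: row) with
`∂ i (g j k) = ∂ j (g i k)`. -/
def intGL (d : Fin m → Derivation ℤ F F) : Set (GL (Fin m) F) :=
  {g | ∀ i j k, d i (g j k) = d j (g i k)}

/-- The system `g⁻¹ ∂`. -/
def act (g : GL (Fin m) F) (d : Fin m → Derivation ℤ F F) : Fin m → Derivation ℤ F F :=
  combo ((g⁻¹ : GL (Fin m) F) : Matrix (Fin m) (Fin m) F) d

/-- The base `𝐁` of the groupoid: all systems `g⁻¹ ∂` with `g ∈ GL^∂(m, F)`. -/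
def base (d : Fin m → Derivation ℤ F F) : Set (Fin m → Derivation ℤ F F) :=
  {δ | ∃ g ∈ intGL d, δ = act g d}

theorem combo_apply {A : Type*} [CommRing A] (M : Matrix (Fin m) (Fin m) A)
    (D : Fin m → Derivation ℤ A A) (i : Fin m) (x : A) :
    combo M D i x = ∑ j, M i j * D j x := by
  have h : ∀ s : Finset (Fin m), (∑ j ∈ s, M i j • D j) x = ∑ j ∈ s, M i j * D j x := by
    intro s
    induction s using Finset.induction_on with
    | empty => simp
    | insert a s ha ih => simp [Finset.sum_insert ha, ih]
  exact h _

theorem sum_act (g : GL (Fin m) F) (d : Fin m → Derivation ℤ F F) (i : Fin m) (x : F) :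
    d i x = ∑ j, g i j * act g d j x := by
  have h : (g : Matrix (Fin m) (Fin m) F) *ᵥ
      (((g⁻¹ : GL (Fin m) F) : Matrix (Fin m) (Fin m) F) *ᵥ fun j => d j x) =
      fun j => d j x := by
    rw [Matrix.mulVec_mulVec, ← Units.val_mul, mul_inv_cancel, Units.val_one,
      Matrix.one_mulVec]
  have h2 := congrFun h i
  simp only [Matrix.mulVec, dotProduct] at h2
  simp only [act, combo_apply]
  exact h2.symm

theorem commuting_act {d : Fin m → Derivation ℤ F F} (hd : Commuting d) {g : GL (Fin m) F}
    (hg : g ∈ intGL d) : Commuting (act g d) := by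
  intro p q x
  let G : Matrix (Fin m) (Fin m) F := g.val
  have hG : G = g.val := rfl
  let E : Matrix (Fin m) (Fin m) F :=
    Matrix.of fun s k => act g d s (act g d k x) - act g d k (act g d s x)
  have key : ∀ a b, d a (d b x) = ∑ k, d a (G b k) * act g d k x +
      ∑ k, ∑ s, G a s * G b k * act g d s (act g d k x) := by
    intro a b
    rw [sum_act g d b x, map_sum, ← Finset.sum_add_distrib]
    refine Finset.sum_congr rfl fun k _ => ?_
    rw [Derivation.leibniz, sum_act g d a (act g d k x), smul_eq_mul, smul_eq_mul, add_comm,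
      Finset.mul_sum]
    congr 1
    · ring
    · refine Finset.sum_congr rfl fun s _ => ?_
      rw [hG]; ring
  have hE : G * E * Gᵀ = 0 := by
    ext a b
    have h1 := key a b
    have h2 := key b a
    rw [hd a b x, h2] at h1
    have h3 : ∑ k, d b (G a k) * act g d k x = ∑ k, d a (G b k) * act g d k x :=
      Finset.sum_congr rfl fun k _ => by rw [hG, hg b a k]
    rw [h3, add_right_inj] at h1
    have h4 : ∑ k, ∑ s, G b s * G a k * act g d s (act g d k x) =
        ∑ k, ∑ s, G a s * G b k * act g d k (act g d s x) := by
      rw [Finset.sum_comm]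
      exact Finset.sum_congr rfl fun k _ => Finset.sum_congr rfl fun s _ => by ring
    rw [h4] at h1
    simp only [Matrix.mul_apply, Matrix.transpose_apply, Matrix.zero_apply, E, Matrix.of_apply]
    rw [← sub_eq_zero.2 h1.symm, ← Finset.sum_sub_distrib]
    refine Finset.sum_congr rfl fun k _ => ?_
    rw [Finset.sum_mul, ← Finset.sum_sub_distrib]
    exact Finset.sum_congr rfl fun s _ => by ring
  have hu : IsUnit G := Units.isUnit g
  have hut : IsUnit Gᵀ := (Matrix.isUnit_transpose G).2 hu
  have h0 : E = 0 := by
    have h1 : G * E = 0 := hut.mul_left_eq_zero.1 hE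
    exact hu.mul_right_eq_zero.1 h1
  have := congrFun (congrFun h0 p) q
  exact sub_eq_zero.1 this

theorem commuting_of_mem_base {d : Fin m → Derivation ℤ F F} (hd : Commuting d)
    {δ : Fin m → Derivation ℤ F F} (hδ : δ ∈ base d) : Commuting δ := by
  obtain ⟨g, hg, rfl⟩ := hδ
  exact commuting_act hd hg

theorem base_const {d δ : Fin m → Derivation ℤ F F} (hδ : δ ∈ base d) (c : constants d)
    (i : Fin m) : δ i (c : F) = 0 := by
  obtain ⟨g, -, rfl⟩ := hδ
  simp only [act, combo_apply]
  exact Finset.sum_eq_zero fun j _ => by rw [c.2 j, mul_zero]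

theorem jetOp_succ {A : Type*} [CommRing A] {D : Fin m → Derivation ℤ A A} (hD : Commuting D)
    (i : Fin m) (α : Fin m → ℕ) (a : A) :
    D i (jetOp D α a) = jetOp D (α + Pi.single i 1) a := by
  let T : Fin m → Module.End ℤ A := fun i => ((D i : A →ₗ[ℤ] A) : Module.End ℤ A)
  have hT : ∀ i j, Commute (T i) (T j) := fun i j => by
    refine LinearMap.ext fun x => ?_
    exact hD i j x
  have hnot : ∀ l : List (Fin m), i ∉ l →
      (l.map fun j => T j ^ (α + Pi.single i 1 : Fin m → ℕ) j) = l.map fun j => T j ^ α j := by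
    intro l hl
    refine List.map_congr_left fun j hj => ?_
    have : j ≠ i := fun h => hl (h ▸ hj)
    simp [this]
  have main : ∀ l : List (Fin m), l.Nodup → i ∈ l →
      T i * (l.map fun j => T j ^ α j).prod =
        (l.map fun j => T j ^ (α + Pi.single i 1 : Fin m → ℕ) j).prod := by
    intro l
    induction l with
    | nil => simp
    | cons j l ih =>
      intro hnd hi
      rw [List.nodup_cons] at hnd
      rw [List.map_cons, List.map_cons, List.prod_cons, List.prod_cons]
      by_cases hji : j = i
      · subst hji
        rw [hnot l hnd.1, ← mul_assoc, ← pow_succ']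
        simp
      · have hil : i ∈ l := by
          rcases List.mem_cons.1 hi with h | h
          · exact absurd h.symm hji
          · exact h
        rw [← ih hnd.2 hil, ← mul_assoc, ← mul_assoc, ((hT i j).pow_right (α j)).eq]
        simp [hji]
  exact LinearMap.congr_fun (main _ (List.nodup_finRange m) (List.mem_finRange i)) a

theorem evalD_formalD {R A : Type*} [CommRing R] [CommRing A] [Algebra R A] {ι : Type*}
    {D : Fin m → Derivation ℤ A A} (hD : Commuting D)
    (hc : ∀ (c : R) i, D i (algebraMap R A c) = 0) (z : ι → A) (i : Fin m)
    (p : DPoly R m ι) : evalD D z (formalD R ι i p) = D i (evalD D z p) := by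
  induction p using MvPolynomial.induction_on with
  | C c => simp [evalD, formalD, hc]
  | add p q hp hq => simp only [map_add, hp, hq]
  | mul_X p kα hp =>
    rw [Derivation.leibniz, map_mul, Derivation.leibniz, map_add, smul_eq_mul, smul_eq_mul,
      map_mul, map_mul, hp, smul_eq_mul, smul_eq_mul]
    congr 2
    simp [formalD, evalD, MvPolynomial.mkDerivation_X, jetOp_succ hD]

/-! ### Differential rational functions on a family of sets over the base -/

/-- The ideal of the differential polynomials with constant coefficients that vanish on the
family `(S δ)`, `δ ∈ 𝐁`; on `S δ` the derivations are interpreted by `δ`. -/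
def vanishingIdeal (d : Fin m → Derivation ℤ F F) {ι : Type*}
    (S : (Fin m → Derivation ℤ F F) → Set (ι → F)) : Ideal (DPoly (constants d) m ι) where
  carrier := {p | ∀ δ ∈ base d, ∀ z ∈ S δ, evalD δ z p = 0}
  add_mem' := by
    intro p q hp hq δ hδ z hz
    rw [map_add, hp δ hδ z hz, hq δ hδ z hz, add_zero]
  zero_mem' := by intro δ _ z _; exact map_zero _
  smul_mem' := by
    intro c p hp δ hδ z hz
    rw [smul_eq_mul, map_mul, hp δ hδ z hz, mul_zero]

/-- `C{S}`: the differential polynomial functions on the family `S`. -/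
def CoordRing (d : Fin m → Derivation ℤ F F) {ι : Type*}
    (S : (Fin m → Derivation ℤ F F) → Set (ι → F)) : Type _ :=
  DPoly (constants d) m ι ⧸ vanishingIdeal d S

instance (d : Fin m → Derivation ℤ F F) {ι : Type*}
    (S : (Fin m → Derivation ℤ F F) → Set (ι → F)) : CommRing (CoordRing d S) :=
  inferInstanceAs (CommRing (DPoly (constants d) m ι ⧸ vanishingIdeal d S))

instance (d : Fin m → Derivation ℤ F F) {ι : Type*}
    (S : (Fin m → Derivation ℤ F F) → Set (ι → F)) : Algebra (constants d) (CoordRing d S) :=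
  inferInstanceAs (Algebra (constants d) (DPoly (constants d) m ι ⧸ vanishingIdeal d S))

/-- The class in `C{S}` of a differential polynomial. -/
def toCoord (d : Fin m → Derivation ℤ F F) {ι : Type*}
    (S : (Fin m → Derivation ℤ F F) → Set (ι → F)) :
    DPoly (constants d) m ι →+* CoordRing d S :=
  Ideal.Quotient.mk (vanishingIdeal d S)

theorem toCoord_surjective (d : Fin m → Derivation ℤ F F) {ι : Type*}
    (S : (Fin m → Derivation ℤ F F) → Set (ι → F)) : Function.Surjective (toCoord d S) :=
  Ideal.Quotient.mk_surjective

theorem toCoord_eq_zero {d : Fin m → Derivation ℤ F F} {ι : Type*}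
    {S : (Fin m → Derivation ℤ F F) → Set (ι → F)} {p : DPoly (constants d) m ι} :
    toCoord d S p = 0 ↔ p ∈ vanishingIdeal d S :=
  Ideal.Quotient.eq_zero_iff_mem

theorem toCoord_formalD {d : Fin m → Derivation ℤ F F} (hd : Commuting d) {ι : Type*}
    (S : (Fin m → Derivation ℤ F F) → Set (ι → F)) (i : Fin m)
    (p : DPoly (constants d) m ι) (hp : toCoord d S p = 0) :
    toCoord d S (formalD (constants d) ι i p) = 0 := by
  rw [toCoord_eq_zero] at hp ⊢
  intro δ hδ z hz
  have h := evalD_formalD (commuting_of_mem_base hd hδ)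
    (fun (c : constants d) j => base_const hδ c j) z i p
  rw [hp δ hδ z hz, map_zero] at h
  exact h

/-- `C⟨S⟩`: the differential rational functions with constant coefficients on the family
`S`, that is, the total ring of fractions of `C{S}` (its field of fractions, when `C{S}` is an
integral domain). -/
def FunField (d : Fin m → Derivation ℤ F F) {ι : Type*}
    (S : (Fin m → Derivation ℤ F F) → Set (ι → F)) : Type _ :=
  FractionRing (CoordRing d S)

instance (d : Fin m → Derivation ℤ F F) {ι : Type*}
    (S : (Fin m → Derivation ℤ F F) → Set (ι → F)) : CommRing (FunField d S) :=
  inferInstanceAs (CommRing (FractionRing (CoordRing d S)))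

instance (d : Fin m → Derivation ℤ F F) {ι : Type*}
    (S : (Fin m → Derivation ℤ F F) → Set (ι → F)) : Algebra (CoordRing d S) (FunField d S) :=
  inferInstanceAs (Algebra (CoordRing d S) (FractionRing (CoordRing d S)))

instance (d : Fin m → Derivation ℤ F F) {ι : Type*}
    (S : (Fin m → Derivation ℤ F F) → Set (ι → F)) :
    IsFractionRing (CoordRing d S) (FunField d S) :=
  inferInstanceAs (IsFractionRing (CoordRing d S) (FractionRing (CoordRing d S)))

instance (d : Fin m → Derivation ℤ F F) {ι : Type*}
    (S : (Fin m → Derivation ℤ F F) → Set (ι → F)) : Algebra (constants d) (FunField d S) :=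
  inferInstanceAs (Algebra (constants d) (FractionRing (CoordRing d S)))

instance (d : Fin m → Derivation ℤ F F) {ι : Type*}
    (S : (Fin m → Derivation ℤ F F) → Set (ι → F)) :
    IsScalarTower (constants d) (CoordRing d S) (FunField d S) :=
  inferInstanceAs (IsScalarTower (constants d) (CoordRing d S) (FractionRing (CoordRing d S)))

/-- The class in `C⟨S⟩` of a differential polynomial. -/
def toFun (d : Fin m → Derivation ℤ F F) {ι : Type*}
    (S : (Fin m → Derivation ℤ F F) → Set (ι → F)) (p : DPoly (constants d) m ι) :
    FunField d S :=
  algebraMap (CoordRing d S) (FunField d S) (toCoord d S p)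

/-- `f ∈ C⟨S⟩` is defined at the point `z` and has the value `a` there. The point may have its
coordinates in any ring `A` over the constants with a system `D` of derivations. -/
def HasValue {d : Fin m → Derivation ℤ F F} {ι : Type*}
    {S : (Fin m → Derivation ℤ F F) → Set (ι → F)} {A : Type*} [CommRing A]
    [Algebra (constants d) A] (f : FunField d S) (D : Fin m → Derivation ℤ A A) (z : ι → A)
    (a : A) : Prop :=
  ∃ r s : DPoly (constants d) m ι, f * toFun d S s = toFun d S r ∧
    IsUnit (evalD D z s) ∧ a * evalD D z s = evalD D z r

/-- The extension of a derivation to the total ring of fractions (quotient rule). -/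
def fracD {A K : Type*} [CommRing A] [CommRing K] [Algebra A K] [IsFractionRing A K]
    (D : Derivation ℤ A A) : Derivation ℤ K K :=
  let φ : A →+* TrivSqZeroExt K K :=
    { toFun := fun a => TrivSqZeroExt.inl (algebraMap A K a) +
        TrivSqZeroExt.inr (algebraMap A K (D a))
      map_one' := by ext <;> simp
      map_zero' := by ext <;> simp
      map_add' := by intro a b; ext <;> simp [Algebra.smul_def]
      map_mul' := by
        intro a b
        ext
        · simp
        · simp only [TrivSqZeroExt.snd_add, TrivSqZeroExt.snd_inl, TrivSqZeroExt.snd_inr,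
            TrivSqZeroExt.snd_mul, TrivSqZeroExt.fst_add, TrivSqZeroExt.fst_inl,
            TrivSqZeroExt.fst_inr, Derivation.leibniz, smul_eq_mul, map_add, map_mul,
            op_smul_eq_smul, zero_add, add_zero] }
  have hφ : ∀ y : nonZeroDivisors A, IsUnit (φ y) := fun y => by
    rw [TrivSqZeroExt.isUnit_iff_isUnit_fst]
    simpa [φ] using IsLocalization.map_units K y
  let Φ : K →+* TrivSqZeroExt K K := IsLocalization.lift hφ
  have hfst : ∀ f, (Φ f).fst = f := by
    have h : ((TrivSqZeroExt.fstHom K K K).toRingHom.comp Φ) = RingHom.id _ := by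
      refine IsLocalization.ringHom_ext (nonZeroDivisors A) ?_
      ext a
      simp [Φ, φ]
    exact fun f => RingHom.congr_fun h f
  Derivation.mk'
    (AddMonoidHom.toIntLinearMap
      { toFun := fun f => (Φ f).snd
        map_zero' := by simp
        map_add' := fun f g => by rw [map_add]; rfl })
    (fun f g => by
      change (Φ (f * g)).snd = f • (Φ g).snd + g • (Φ f).snd
      rw [map_mul, TrivSqZeroExt.snd_mul, hfst, hfst, op_smul_eq_smul])

theorem fracD_algebraMap {A K : Type*} [CommRing A] [CommRing K] [Algebra A K]
    [IsFractionRing A K] (D : Derivation ℤ A A) (a : A) :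
    fracD (K := K) D (algebraMap A K a) = algebraMap A K (D a) := by
  change (IsLocalization.lift _ (algebraMap A K a) : TrivSqZeroExt K K).snd = _
  rw [IsLocalization.lift_eq]
  simp only [RingHom.coe_mk, MonoidHom.coe_mk, OneHom.coe_mk, TrivSqZeroExt.snd_add,
    TrivSqZeroExt.snd_inl, TrivSqZeroExt.snd_inr, zero_add]

/-- The derivation induced on the image of a surjective ring homomorphism. -/
def quotD {R A Q : Type*} [CommRing R] [CommRing A] [Algebra R A] [CommRing Q] (π : A →+* Q)
    (hπ : Function.Surjective π) (D : Derivation R A A)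
    (h : ∀ a, π a = 0 → π (D a) = 0) : Derivation ℤ Q Q :=
  Derivation.liftOfSurjective (f := π.toIntAlgHom) (d := D.restrictScalars ℤ) hπ h

theorem quotD_apply {R A Q : Type*} [CommRing R] [CommRing A] [Algebra R A] [CommRing Q]
    (π : A →+* Q) (hπ : Function.Surjective π) (D : Derivation R A A)
    (h : ∀ a, π a = 0 → π (D a) = 0) (a : A) : quotD π hπ D h (π a) = π (D a) :=
  Derivation.liftOfSurjective_apply (f := π.toIntAlgHom) (d := D.restrictScalars ℤ) hπ h a

/-- The derivation `∂ i` of the coordinate ring `C{S}`. -/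
def coordD {d : Fin m → Derivation ℤ F F} (hd : Commuting d) {ι : Type*}
    (S : (Fin m → Derivation ℤ F F) → Set (ι → F)) (i : Fin m) :
    Derivation ℤ (CoordRing d S) (CoordRing d S) :=
  quotD (toCoord d S) (toCoord_surjective d S)
    (formalD (constants d) ι i) (toCoord_formalD hd S i)

/-- The derivations `∂ i` of `C⟨S⟩`. -/
def funD {d : Fin m → Derivation ℤ F F} (hd : Commuting d) {ι : Type*}
    (S : (Fin m → Derivation ℤ F F) → Set (ι → F)) (i : Fin m) :
    Derivation ℤ (FunField d S) (FunField d S) :=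
  fracD (coordD hd S i)

theorem funD_toFun {d : Fin m → Derivation ℤ F F} (hd : Commuting d) {ι : Type*}
    (S : (Fin m → Derivation ℤ F F) → Set (ι → F)) (i : Fin m)
    (p : DPoly (constants d) m ι) :
    funD hd S i (toFun d S p) = toFun d S (formalD (constants d) ι i p) := by
  rw [funD, toFun, fracD_algebraMap, coordD, quotD_apply, toFun]

/-- The coordinate function `x k` in `C⟨S⟩`. -/
def coord (d : Fin m → Derivation ℤ F F) {ι : Type*}
    (S : (Fin m → Derivation ℤ F F) → Set (ι → F)) (k : ι) : FunField d S :=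
  toFun d S (MvPolynomial.X (k, 0))

/-! ### The groupoid action -/

/-- The indices of the components of a triple `(h, g, v)` in
`GL(n) × GL(m) × (affine l-space)`. -/
abbrev TripleIdx (n m l : ℕ) : Type := (Fin n × Fin n) ⊕ (Fin m × Fin m) ⊕ Fin l

/-- The vector of all components of `(h, g, v)`. -/
def triple {A : Type*} {n m l : ℕ} (h : Matrix (Fin n) (Fin n) A) (g : Matrix (Fin m) (Fin m) A)
    (v : Fin l → A) : TripleIdx n m l → A :=
  Sum.elim (fun ij => h ij.1 ij.2) (Sum.elim (fun ij => g ij.1 ij.2) v)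

/-- The family `G ⋄ W`, with the fibre `GL(n, F) × GL^δ(m, F) × W δ` over `δ`. -/
def diamond (n : ℕ) {l : ℕ} (W : (Fin m → Derivation ℤ F F) → Set (Fin l → F)) :
    (Fin m → Derivation ℤ F F) → Set (TripleIdx n m l → F) :=
  fun δ => {z | ∃ (h : GL (Fin n) F) (g : GL (Fin m) F) (v : Fin l → F),
    g ∈ intGL δ ∧ v ∈ W δ ∧ z = triple h.val g.val v}

/-- `C⟨W⟩^G`: the `f ∈ C⟨W⟩` with `f^(g⁻¹δ)⟨τ^δ⟨h, g; v⟩⟩ = f^δ⟨v⟩` for all `δ ∈ 𝐁`,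
`(h, g) ∈ GL(n, F) × GL^δ(m, F)`, `v ∈ W δ` for which both sides are defined. -/
def invariants {d : Fin m → Derivation ℤ F F} {n l : ℕ}
    (W : (Fin m → Derivation ℤ F F) → Set (Fin l → F))
    (τ : (Fin m → Derivation ℤ F F) → GL (Fin n) F → GL (Fin m) F → (Fin l → F) → (Fin l → F)) :
    Set (FunField d W) :=
  {f | ∀ δ ∈ base d, ∀ (h : GL (Fin n) F), ∀ g ∈ intGL δ, ∀ v ∈ W δ, ∀ a b : F,
    HasValue f δ v a → HasValue f (act g δ) (τ δ h g v) b → b = a}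

end Field

/-- The smallest subalgebra over `R` that contains `X`, is closed under the derivations `D i`,
and contains the inverse of each of its elements that is invertible in `K`. When `K` and `R` are
fields this is the `D`-differential subfield of `K` generated by `X` over `R`. -/
def diffFieldAdjoin (R : Type*) {K : Type*} [CommRing R] [CommRing K] [Algebra R K] {m : ℕ}
    (D : Fin m → Derivation ℤ K K) (X : Set K) : Subalgebra R K :=
  sInf {L | X ⊆ L ∧ (∀ i, ∀ a ∈ L, D i a ∈ L) ∧ ∀ a ∈ L, ∀ b, a * b = 1 → b ∈ L}

end DiffInv

end

/-!
Because `F` is differentially closed, every `g ∈ GL^δ(m, F)` is the Jacobian `δ y` of a vector `y`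
of potentials. The arrows of the groupoid that start at a given point are thus parametrized by an
open part of an affine space, so that identities between differential rational functions may be
checked generically.

The normal form of `(δ, v)`, consisting of the system `P₁⟨v⟩⁻¹ δ` and the point `τ⟨P⟨v⟩; v⟩`, is
constant on the orbits. Hence every `δ`-differential rational function of `w = τ⟨P⟨x⟩; x⟩` is
invariant. Conversely, an invariant `f = r / s` is constant along the arrows `(h, g)` that start at
the normal form of `(δ, v)`, with the value `f^δ⟨v⟩`. There `r / s` at the endpoint is a quotient
`R / S` of differential polynomials in `(h, y, w)`, so that `R = f S` identically in `(h, y)`, and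
`f` is the quotient of two corresponding coefficients, which are differential polynomials in `w`.
Comparing coefficients is necessary because `f` need not be defined at the normal form itself.
-/

noncomputable section

namespace DiffInv

/-! ### Derivations of polynomial rings and of fields of fractions -/

/-- The derivations over `ℤ` of a commutative ring. For a polynomial ring `A`, elaborating
`Derivation ℤ A A` finds the `ℤ`-algebra structure that comes from the coefficients; in `Der A` it
is the one of an arbitrary ring, as in `Commuting`, `jetOp` and `evalD`. -/
abbrev Der (A : Type*) [CommRing A] : Type _ := Derivation ℤ A A

/-- The derivation of a polynomial ring that applies the derivation `δ` to the coefficients. -/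
def coeffD {R : Type*} [CommRing R] (σ : Type*) (δ : Derivation ℤ R R) :
    Der (MvPolynomial σ R) :=
  have coeff_map (p : MvPolynomial σ R) (s : σ →₀ ℕ) :
      MvPolynomial.coeff s (AddMonoidAlgebra.map (δ : R →+ R) p) = δ (p.coeff s) := rfl
  Derivation.mk'
    (AddMonoidHom.toIntLinearMap
      { toFun := AddMonoidAlgebra.map (δ : R →+ R)
        map_zero' := AddMonoidAlgebra.map_zero _
        map_add' := AddMonoidAlgebra.map_add _ })
    fun p q => by
      classical
      ext s
      simp only [AddMonoidHom.coe_toIntLinearMap, AddMonoidHom.coe_mk, ZeroHom.coe_mk, coeff_map,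
        smul_eq_mul, MvPolynomial.coeff_add, mul_comm q, MvPolynomial.coeff_mul, map_sum,
        Derivation.leibniz, Finset.sum_add_distrib]
      congr 1
      exact Finset.sum_congr rfl fun _ _ => mul_comm _ _

theorem coeffD_C {R σ : Type*} [CommRing R] (δ : Derivation ℤ R R) (a : R) :
    coeffD σ δ (MvPolynomial.C a) = MvPolynomial.C (δ a) :=
  AddMonoidAlgebra.map_single ..

theorem coeffD_X {R σ : Type*} [CommRing R] (δ : Derivation ℤ R R) (s : σ) :
    coeffD σ δ (MvPolynomial.X s) = 0 :=
  (AddMonoidAlgebra.map_single ..).trans (by simp)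

/-- The derivation of a polynomial ring that extends the derivation `δ` of the coefficients and
takes the value `u s` at the indeterminate `s`. -/
def polyD {R σ : Type*} [CommRing R] (δ : Derivation ℤ R R) (u : σ → MvPolynomial σ R) :
    Der (MvPolynomial σ R) :=
  let U : Der (MvPolynomial σ R) := (MvPolynomial.mkDerivation R u).restrictScalars ℤ
  coeffD σ δ + U

theorem polyD_apply {R σ : Type*} [CommRing R] (δ : Derivation ℤ R R)
    (u : σ → MvPolynomial σ R) (p : MvPolynomial σ R) :
    polyD δ u p = coeffD σ δ p + MvPolynomial.mkDerivation R u p :=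
  rfl

@[simp]
theorem polyD_C {R σ : Type*} [CommRing R] (δ : Derivation ℤ R R) (u : σ → MvPolynomial σ R)
    (a : R) : polyD δ u (MvPolynomial.C a) = MvPolynomial.C (δ a) := by
  simp [polyD_apply, coeffD_C]

@[simp]
theorem polyD_X {R σ : Type*} [CommRing R] (δ : Derivation ℤ R R) (u : σ → MvPolynomial σ R)
    (s : σ) : polyD δ u (MvPolynomial.X s) = u s := by
  simp [polyD_apply, coeffD_X]

theorem commuting_polyD {R σ : Type*} [CommRing R] {m : ℕ} {δ : Fin m → Derivation ℤ R R}
    (hδ : Commuting δ) (u : Fin m → σ → MvPolynomial σ R)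
    (hu : ∀ i j s, polyD (δ i) (u i) (u j s) = polyD (δ j) (u j) (u i s)) :
    Commuting fun i => polyD (δ i) (u i) := by
  intro i j p
  dsimp only
  induction p using MvPolynomial.induction_on with
  | C a => simp only [polyD_C, hδ i j a]
  | add p q hp hq => simp only [map_add, hp, hq]
  | mul_X p s hp =>
    simp only [Derivation.leibniz, map_add, smul_eq_mul, polyD_X, hp, hu i j]
    ring

theorem commuting_fracD {A K : Type*} [CommRing A] [CommRing K] [Algebra A K]
    [IsFractionRing A K] {m : ℕ} {D : Fin m → Derivation ℤ A A} (hD : Commuting D) :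
    Commuting fun i => fracD (K := K) (D i) := by
  intro i j f
  obtain ⟨⟨r, s⟩, hrs⟩ := IsLocalization.surj (nonZeroDivisors A) f
  let E : Derivation ℤ K K := ⁅fracD (K := K) (D i), fracD (K := K) (D j)⁆
  have hE (a : A) : E (algebraMap A K a) = 0 := by
    simp [E, Derivation.commutator_apply, fracD_algebraMap, hD i j a]
  have h := congrArg E hrs
  rw [Derivation.leibniz, hE, hE, smul_zero, zero_add, smul_eq_mul] at h
  exact sub_eq_zero.1 ((IsLocalization.map_units K s).mul_right_eq_zero.1 h)

/-! ### Jets and evaluation -/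

theorem multiIndex_induction {m : ℕ} {P : (Fin m → ℕ) → Prop} (zero : P 0)
    (succ : ∀ α i, P α → P (α + Pi.single i 1)) (α : Fin m → ℕ) : P α := by
  induction α using WellFoundedLT.induction with
  | ind α ih =>
    rcases eq_or_ne α 0 with rfl | hα
    · exact zero
    · obtain ⟨i, hi⟩ := Function.ne_iff.1 hα
      have hle : Pi.single i 1 ≤ α :=
        update_le_iff.2 ⟨Nat.one_le_iff_ne_zero.2 hi, fun _ _ => Nat.zero_le _⟩
      have hlt : α - Pi.single i 1 < α := by
        refine lt_of_le_of_ne tsub_le_self fun h => ?_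
        have := congrFun h i
        simp only [Pi.sub_apply, Pi.single_eq_same, Pi.zero_apply] at this hi
        omega
      exact tsub_add_cancel_of_le hle ▸ succ _ i (ih _ hlt)

section Jets

variable {A B : Type*} [CommRing A] [CommRing B] {m : ℕ} {D : Fin m → Derivation ℤ A A}
  {D' : Fin m → Derivation ℤ B B}

theorem jetOp_zero (D : Fin m → Derivation ℤ A A) (a : A) : jetOp D 0 a = a := by
  simp [jetOp]

theorem jetOp_induction {Q : A → Prop} (hQ : ∀ i a, Q a → Q (D i a)) (α : Fin m → ℕ) {a : A}
    (ha : Q a) : Q (jetOp D α a) := by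
  let S : Submonoid (Module.End ℤ A) :=
    { carrier := {T | ∀ a, Q a → Q (T a)}
      one_mem' := fun _ h => h
      mul_mem' := fun hT hU a h => hT _ (hU a h) }
  have h : jetOp D α ∈ S := by
    refine S.list_prod_mem fun T hT => ?_
    obtain ⟨i, -, rfl⟩ := List.mem_map.1 hT
    exact S.pow_mem (hQ i) _
  exact h a ha

theorem jetOp_single (hD : Commuting D) (i : Fin m) (a : A) :
    jetOp D (Pi.single i 1) a = D i a := by
  have h := jetOp_succ hD i 0 a
  rw [jetOp_zero, zero_add] at h
  exact h.symm

theorem map_jetOp {φ : A → B} (hφ : ∀ i a, φ (D i a) = D' i (φ a)) (α : Fin m → ℕ) (a : A) :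
    φ (jetOp D α a) = jetOp D' α (φ a) := by
  have hlist (L : List (Fin m)) :
      φ ((L.map fun i => ((D i : A →ₗ[ℤ] A) : Module.End ℤ A) ^ α i).prod a) =
        (L.map fun i => ((D' i : B →ₗ[ℤ] B) : Module.End ℤ B) ^ α i).prod (φ a) := by
    induction L with
    | nil => rfl
    | cons i L ih =>
      simp only [List.map_cons, List.prod_cons, Module.End.mul_apply, Module.End.pow_apply, ← ih]
      exact (show Function.Semiconj φ (D i) (D' i) from hφ i).iterate_right (α i) _
  exact hlist _

variable {R : Type*} [CommRing R] [Algebra R A] [Algebra R B] {ι κ : Type*}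

theorem map_evalD (φ : A →ₐ[R] B) (hφ : ∀ i a, φ (D i a) = D' i (φ a)) (z : ι → A)
    (p : DPoly R m ι) : φ (evalD D z p) = evalD D' (fun k => φ (z k)) p := by
  rw [evalD, MvPolynomial.comp_aeval_apply, evalD]
  simp only [map_jetOp hφ]

@[simp]
theorem evalD_X (D : Fin m → Derivation ℤ A A) (z : ι → A) (kα : ι × (Fin m → ℕ)) :
    evalD (R := R) D z (MvPolynomial.X kα) = jetOp D kα.2 (z kα.1) :=
  MvPolynomial.aeval_X _ _

@[simp]
theorem evalD_C (D : Fin m → Derivation ℤ A A) (z : ι → A) (c : R) :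
    evalD D z (MvPolynomial.C c) = algebraMap R A c :=
  MvPolynomial.aeval_C _ _

/-- Renaming of the unknowns of a differential polynomial. -/
def renameD (e : ι → κ) : DPoly R m ι →ₐ[R] DPoly R m κ :=
  MvPolynomial.rename (Prod.map e id)

theorem evalD_renameD (D : Fin m → Derivation ℤ A A) (e : ι → κ) (z : κ → A)
    (p : DPoly R m ι) : evalD D z (renameD e p) = evalD D (z ∘ e) p :=
  MvPolynomial.aeval_rename ..

end Jets

/-! ### Differential polynomials over a differential ring -/

/-- The `i`-th derivation of the ring of differential polynomials over a ring with the system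
`δ` of derivations. -/
def extD {R : Type*} [CommRing R] {m : ℕ} (δ : Fin m → Derivation ℤ R R) (ι : Type*)
    (i : Fin m) : Der (DPoly R m ι) :=
  polyD (δ i) fun kα => MvPolynomial.X (kα.1, kα.2 + Pi.single i 1)

section ExtD

variable {R : Type*} [CommRing R] {m : ℕ} {δ : Fin m → Derivation ℤ R R}

theorem extD_C (δ : Fin m → Derivation ℤ R R) (ι : Type*) (i : Fin m) (a : R) :
    extD δ ι i (MvPolynomial.C a) = MvPolynomial.C (δ i a) :=
  polyD_C _ _ _

theorem extD_X (δ : Fin m → Derivation ℤ R R) (ι : Type*) (i : Fin m)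
    (kα : ι × (Fin m → ℕ)) :
    extD δ ι i (MvPolynomial.X kα) = MvPolynomial.X (kα.1, kα.2 + Pi.single i 1) :=
  polyD_X _ _ _

theorem commuting_extD (hδ : Commuting δ) (ι : Type*) : Commuting (extD δ ι) :=
  commuting_polyD hδ _ fun i j s => by simp only [polyD_X, add_right_comm]

theorem jetOp_extD_X (hδ : Commuting δ) {ι : Type*} (k : ι) (α : Fin m → ℕ) :
    jetOp (extD δ ι) α (MvPolynomial.X (k, 0)) = MvPolynomial.X (k, α) := by
  induction α using multiIndex_induction with
  | zero => exact jetOp_zero _ _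
  | succ α i ih => rw [← jetOp_succ (commuting_extD hδ ι), ih, extD_X]

theorem evalD_extD_X (hδ : Commuting δ) {ι : Type*} (p : DPoly R m ι) :
    evalD (extD δ ι) (fun k => MvPolynomial.X (k, 0)) p = p := by
  simp only [evalD, jetOp_extD_X hδ]
  exact MvPolynomial.aeval_X_left_apply p

theorem map_extD {S ι : Type*} [CommRing S] {δ' : Fin m → Derivation ℤ S S} (φ : R →+* S)
    (hφ : ∀ i a, φ (δ i a) = δ' i (φ a)) (i : Fin m) (p : DPoly R m ι) :
    MvPolynomial.map φ (extD δ ι i p) = extD δ' ι i (MvPolynomial.map φ p) := by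
  induction p using MvPolynomial.induction_on with
  | C c => simp only [extD_C, MvPolynomial.map_C, hφ]
  | add p q hp hq => simp only [map_add, hp, hq]
  | mul_X p kα hp =>
    simp only [Derivation.leibniz, map_add, map_mul, smul_eq_mul, MvPolynomial.map_X, extD_X, hp]

variable {A : Type*} [CommRing A] [Algebra R A] {D : Fin m → Derivation ℤ A A}

theorem evalD_extD {ι : Type*} (hD : Commuting D)
    (hc : ∀ i r, D i (algebraMap R A r) = algebraMap R A (δ i r)) (z : ι → A) (i : Fin m)
    (p : DPoly R m ι) : evalD D z (extD δ ι i p) = D i (evalD D z p) := by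
  induction p using MvPolynomial.induction_on with
  | C c => simp only [extD_C, evalD_C, hc]
  | add p q hp hq => simp only [map_add, hp, hq]
  | mul_X p kα hp =>
    simp only [Derivation.leibniz, map_add, map_mul, smul_eq_mul, extD_X, evalD_X, hp,
      jetOp_succ hD]

theorem evalD_evalD {R₀ ι κ : Type*} [CommRing R₀] [Algebra R₀ R] [Algebra R₀ A]
    [IsScalarTower R₀ R A] (hD : Commuting D)
    (hc : ∀ i r, D i (algebraMap R A r) = algebraMap R A (δ i r)) (z : ι → A)
    (w : κ → DPoly R m ι) (p : DPoly R₀ m κ) :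
    evalD D z (evalD (extD δ ι) w p) = evalD D (fun k => evalD D z (w k)) p :=
  map_evalD ((evalD D z).restrictScalars R₀) (evalD_extD hD hc z) w p

end ExtD

/-! ### Linear changes of derivations -/

theorem combo_combo {A : Type*} [CommRing A] {m : ℕ} (M N : Matrix (Fin m) (Fin m) A)
    (D : Fin m → Derivation ℤ A A) : combo M (combo N D) = combo (M * N) D := by
  funext i
  ext x
  simp only [combo_apply, Matrix.mul_apply, Finset.mul_sum, Finset.sum_mul, mul_assoc]
  exact Finset.sum_comm

theorem combo_one {A : Type*} [CommRing A] {m : ℕ} (D : Fin m → Derivation ℤ A A) :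
    combo 1 D = D := by
  funext i
  ext x
  simp [combo_apply, Matrix.one_apply]

theorem map_combo {A B : Type*} [CommRing A] [CommRing B] {m : ℕ}
    {D : Fin m → Derivation ℤ A A} {D' : Fin m → Derivation ℤ B B} (φ : A →+* B)
    (hφ : ∀ i a, φ (D i a) = D' i (φ a)) (M : Matrix (Fin m) (Fin m) A) (i : Fin m) (a : A) :
    φ (combo M D i a) = combo (M.map φ) D' i (φ a) := by
  simp only [combo_apply, map_sum, map_mul, hφ, Matrix.map_apply]

/-- The rewriting of a differential polynomial in the derivations `M δ` as one in the
derivations `δ`. -/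
def recombine {R : Type*} [CommRing R] {m : ℕ} (δ : Fin m → Derivation ℤ R R)
    (M : Matrix (Fin m) (Fin m) R) (ι : Type*) : DPoly R m ι →ₐ[R] DPoly R m ι :=
  evalD (combo (M.map MvPolynomial.C) (extD δ ι)) fun k => MvPolynomial.X (k, 0)

theorem evalD_recombine {R A : Type*} [CommRing R] [CommRing A] [Algebra R A] {m : ℕ}
    {δ : Fin m → Derivation ℤ R R} {D : Fin m → Derivation ℤ A A} {ι : Type*} (hD : Commuting D)
    (hc : ∀ i r, D i (algebraMap R A r) = algebraMap R A (δ i r))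
    (M : Matrix (Fin m) (Fin m) R) (z : ι → A) (p : DPoly R m ι) :
    evalD D z (recombine δ M ι p) = evalD (combo (M.map (algebraMap R A)) D) z p := by
  have hM : (M.map MvPolynomial.C).map (evalD D z : DPoly R m ι →ₐ[R] A) =
      M.map (algebraMap R A) :=
    Matrix.ext fun i j => evalD_C D z _
  have h := map_evalD (D' := combo (M.map (algebraMap R A)) D) (evalD (R := R) D z)
    (fun i a => by
      rw [← hM]
      exact map_combo (evalD (R := R) D z : DPoly R m ι →+* A) (evalD_extD hD hc z) _ i a)
    (fun k => MvPolynomial.X (k, 0)) p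
  simp only [evalD_X, jetOp_zero] at h
  exact h

section Field

variable {F : Type u} [Field F] {m : ℕ} {d δ : Fin m → Derivation ℤ F F}

theorem act_one (d : Fin m → Derivation ℤ F F) : act 1 d = d := by
  rw [act, inv_one, Units.val_one, combo_one]

theorem act_act (g g₁ : GL (Fin m) F) (d : Fin m → Derivation ℤ F F) :
    act g₁ (act g d) = act (g * g₁) d := by
  rw [act, act, act, combo_combo, mul_inv_rev, Units.val_mul]

theorem act_inv_act (g : GL (Fin m) F) (d : Fin m → Derivation ℤ F F) :
    act g⁻¹ (act g d) = d := by
  rw [act_act, mul_inv_cancel, act_one]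

/-- The Jacobian matrix `(δ i (y k))` of a vector `y`; for commuting `δ` it lies in `GL^δ(m, F)`
as soon as it is invertible. -/
def jacobian {κ : Type*} (δ : Fin m → Derivation ℤ F F) (y : κ → F) : Matrix (Fin m) κ F :=
  Matrix.of fun i k => δ i (y k)

theorem mem_intGL_iff {g : GL (Fin m) F} :
    g ∈ intGL d ↔ ∀ k, (jacobian d (g.val.col k)).IsSymm :=
  ⟨fun h k => Matrix.IsSymm.ext fun i j => h j i k, fun h i j k => (h k).apply j i⟩

theorem jacobian_mulVec (g : GL (Fin m) F) (v : Fin m → F) :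
    jacobian d (g.val *ᵥ v) =
      ∑ k, v k • jacobian d (g.val.col k) + g.val * jacobian (act g d) v * g.valᵀ := by
  ext i j
  simp only [jacobian, Matrix.mulVec, dotProduct, Matrix.of_apply, map_sum, Derivation.leibniz,
    smul_eq_mul, Finset.sum_add_distrib, Matrix.add_apply, Matrix.sum_apply, Matrix.smul_apply,
    Matrix.col_apply, Matrix.mul_apply, Matrix.transpose_apply]
  rw [add_comm]
  refine congrArg _ (Finset.sum_congr rfl fun k _ => ?_)
  rw [sum_act g d i (v k), mul_comm]

theorem isSymm_jacobian_mulVec_iff {g : GL (Fin m) F} (hg : g ∈ intGL d) (v : Fin m → F) :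
    (jacobian d (g.val *ᵥ v)).IsSymm ↔ (jacobian (act g d) v).IsSymm := by
  have hsum : (∑ k, v k • jacobian d (g.val.col k))ᵀ = ∑ k, v k • jacobian d (g.val.col k) := by
    rw [Matrix.transpose_sum]
    exact Finset.sum_congr rfl fun k _ => (mem_intGL_iff.1 hg k).smul (v k)
  have hgt : IsUnit g.valᵀ := (Matrix.isUnit_transpose _).2 g.isUnit
  rw [jacobian_mulVec, Matrix.IsSymm, Matrix.transpose_add, hsum, add_right_inj,
    Matrix.transpose_mul, Matrix.transpose_mul, Matrix.transpose_transpose, ← mul_assoc,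
    hgt.mul_left_inj, g.isUnit.mul_right_inj, Matrix.IsSymm]

theorem mul_mem_intGL_iff {g g₁ : GL (Fin m) F} (hg : g ∈ intGL d) :
    g * g₁ ∈ intGL d ↔ g₁ ∈ intGL (act g d) := by
  rw [mem_intGL_iff, mem_intGL_iff]
  exact forall_congr' fun k => isSymm_jacobian_mulVec_iff hg _

theorem one_mem_intGL (d : Fin m → Derivation ℤ F F) : (1 : GL (Fin m) F) ∈ intGL d := by
  intro i j k
  simp only [Units.val_one, Matrix.one_apply]
  split_ifs <;> simp

theorem inv_mem_intGL {g : GL (Fin m) F} (hg : g ∈ intGL d) : g⁻¹ ∈ intGL (act g d) := by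
  rw [← mul_mem_intGL_iff hg, mul_inv_cancel]
  exact one_mem_intGL d

theorem self_mem_base (d : Fin m → Derivation ℤ F F) : d ∈ base d :=
  ⟨1, one_mem_intGL d, (act_one d).symm⟩

theorem act_mem_base (hδ : δ ∈ base d) {g : GL (Fin m) F} (hg : g ∈ intGL δ) :
    act g δ ∈ base d := by
  obtain ⟨g₀, hg₀, rfl⟩ := hδ
  exact ⟨g₀ * g, (mul_mem_intGL_iff hg₀).2 hg, act_act _ _ _⟩

theorem exists_act_eq {δ₁ : Fin m → Derivation ℤ F F} (hδ : δ ∈ base d) (hδ₁ : δ₁ ∈ base d) :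
    ∃ g ∈ intGL δ, act g δ = δ₁ := by
  obtain ⟨g₀, hg₀, rfl⟩ := hδ
  obtain ⟨g₁, hg₁, rfl⟩ := hδ₁
  refine ⟨g₀⁻¹ * g₁, (mul_mem_intGL_iff (inv_mem_intGL hg₀)).2 ?_, ?_⟩
  · rwa [act_inv_act]
  · rw [← act_act, act_inv_act]

/-! ### Differentially closed fields -/

theorem fracD_algebraMap_tower {R A K : Type*} [CommRing R] [CommRing A] [CommRing K]
    [Algebra R A] [Algebra A K] [Algebra R K] [IsScalarTower R A K] [IsFractionRing A K]
    {δ : Derivation ℤ R R} {D : Derivation ℤ A A}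
    (h : ∀ r, D (algebraMap R A r) = algebraMap R A (δ r)) (r : R) :
    fracD (K := K) D (algebraMap R K r) = algebraMap R K (δ r) := by
  rw [IsScalarTower.algebraMap_apply R A, fracD_algebraMap, h,
    ← IsScalarTower.algebraMap_apply R A]

theorem IsDiffClosed.exists_evalD_ne_zero (hd : Commuting d) (hF : IsDiffClosed d) {ι : Type*}
    [Finite ι] {q : DPoly F m ι} (hq : q ≠ 0) : ∃ z : ι → F, evalD d z q ≠ 0 := by
  obtain ⟨k, ⟨e⟩⟩ := Finite.exists_equiv_fin ι
  let K := FractionRing (DPoly F m (Fin k))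
  let φ : DPoly F m (Fin k) →ₐ[F] K := IsScalarTower.toAlgHom F _ K
  have hq' : renameD e q ≠ 0 := (map_ne_zero_iff _ (MvPolynomial.rename_injective _
    (e.injective.prodMap Function.injective_id))).2 hq
  have hgeneric : evalD (fun i => fracD (extD d (Fin k) i))
      (fun j => φ (MvPolynomial.X (j, 0))) (renameD e q) = φ (renameD e q) := by
    rw [← map_evalD φ (fun i a => (fracD_algebraMap _ a).symm), evalD_extD_X hd]
  obtain ⟨z, -, hz⟩ := hF k ∅ (renameD e q) ⟨K, inferInstance, inferInstance, _,
    commuting_fracD (commuting_extD hd _), fun i => fracD_algebraMap_tower (extD_C d _ i), _,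
    by simp, hgeneric.trans_ne ((map_ne_zero_iff φ (IsFractionRing.injective _ K)).2 hq')⟩
  exact ⟨z ∘ e, by rwa [evalD_renameD] at hz⟩

/-- The potential is first adjoined as a new indeterminate `X` with `d i X = c i`. -/
theorem IsDiffClosed.exists_potential (hd : Commuting d) (hF : IsDiffClosed d) {c : Fin m → F}
    (hc : ∀ i j, d i (c j) = d j (c i)) : ∃ y, ∀ i, d i y = c i := by
  classical
  let K := FractionRing (MvPolynomial Unit F)
  let D : Fin m → Der (MvPolynomial Unit F) :=
    fun i => polyD (d i) fun _ => MvPolynomial.C (c i)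
  have hD : Commuting fun i => fracD (K := K) (D i) :=
    commuting_fracD (commuting_polyD hd _ fun i j _ => by simp only [polyD_C, hc i j])
  let eqn (i : Fin m) : DPoly F m (Fin 1) :=
    MvPolynomial.X (0, Pi.single i 1) - MvPolynomial.C (c i)
  have hX : ∀ p ∈ Finset.univ.image eqn, evalD (fun i => fracD (K := K) (D i))
      (fun _ => algebraMap (MvPolynomial Unit F) K (MvPolynomial.X ())) p = 0 := by
    intro p hp
    obtain ⟨i, -, rfl⟩ := Finset.mem_image.1 hp
    rw [map_sub, evalD_X, evalD_C, jetOp_single hD, fracD_algebraMap, polyD_X,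
      ← MvPolynomial.algebraMap_eq, ← IsScalarTower.algebraMap_apply, sub_self]
  obtain ⟨z, hz, -⟩ := hF 1 (Finset.univ.image eqn) 1 ⟨K, inferInstance, inferInstance, _, hD,
    fun i => fracD_algebraMap_tower (D := D i) (fun r => polyD_C (d i) _ r), _, hX, by simp⟩
  refine ⟨z 0, fun i => ?_⟩
  have h := hz _ (Finset.mem_image_of_mem eqn (Finset.mem_univ i))
  rwa [map_sub, evalD_X, evalD_C, jetOp_single hd, sub_eq_zero] at h

theorem IsDiffClosed.exists_jacobian_eq (hd : Commuting d) (hF : IsDiffClosed d)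
    {g : GL (Fin m) F} (hg : g ∈ intGL d) : ∃ y : Fin m → F, jacobian d y = g := by
  choose y hy using fun k => hF.exists_potential hd fun i j => hg i j k
  exact ⟨y, Matrix.ext fun i k => hy k i⟩

section Extension

variable {L : Type*} [Field L] [Algebra F L] {D : Fin m → Derivation ℤ L L}

theorem act_map_algebraMap (hD : ∀ i a, D i (algebraMap F L a) = algebraMap F L (d i a))
    (g : GL (Fin m) F) (i : Fin m) (a : F) :
    act (Matrix.GeneralLinearGroup.map (algebraMap F L) g) D i (algebraMap F L a) =
      algebraMap F L (act g d i a) := by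
  rw [act, act, map_combo (algebraMap F L) (fun i a => (hD i a).symm), ← map_inv]
  rfl

theorem map_mem_intGL (hD : ∀ i a, D i (algebraMap F L a) = algebraMap F L (d i a))
    {g : GL (Fin m) F} (hg : g ∈ intGL d) :
    Matrix.GeneralLinearGroup.map (algebraMap F L) g ∈ intGL D := fun i j k => by
  simp only [Matrix.GeneralLinearGroup.map_apply, hD, hg i j k]

end Extension

theorem isDiffClosed_of_mem_base (hd : Commuting d) (hF : IsDiffClosed d) (hδ : δ ∈ base d) :
    IsDiffClosed δ := by
  obtain ⟨g, hg, rfl⟩ := hδ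
  classical
  rintro k E q ⟨L, _, _, D, hD, hDF, z, hz, hq⟩
  let gL : GL (Fin m) L := Matrix.GeneralLinearGroup.map (algebraMap F L) g⁻¹
  have hgL : gL ∈ intGL D := map_mem_intGL hDF (inv_mem_intGL hg)
  have hext (i : Fin m) (a : F) :
      act gL D i (algebraMap F L a) = algebraMap F L (d i a) := by
    rw [act_map_algebraMap hDF, act_inv_act]
  let rewriteD := recombine d (g⁻¹ : GL (Fin m) F).val (Fin k)
  have hL (p : DPoly F m (Fin k)) :
      evalD (act gL D) z (rewriteD p) = evalD D z p := by
    rw [evalD_recombine (commuting_act hD hgL) hext]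
    have hg' : (g⁻¹ : GL (Fin m) F).val.map (algebraMap F L) = (gL⁻¹)⁻¹.val := by
      rw [inv_inv]
      rfl
    rw [hg', ← act, act_inv_act]
  have hF' (x : Fin k → F) (p : DPoly F m (Fin k)) :
      evalD d x (rewriteD p) = evalD (act g d) x p :=
    evalD_recombine hd (fun _ _ => rfl) _ x p
  obtain ⟨x, hx, hxq⟩ := hF k (E.image rewriteD) (rewriteD q) ⟨L, inferInstance, inferInstance,
    act gL D, commuting_act hD hgL, hext, z,
    Finset.forall_mem_image.2 fun p hp => (hL p).trans (hz p hp), (hL q).trans_ne hq⟩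
  exact ⟨x, fun p hp => (hF' x p).symm.trans (hx _ (Finset.mem_image_of_mem _ hp)),
    (hF' x q).symm.trans_ne hxq⟩

end Field

/-! ### Values of differential rational functions -/

theorem evalD_mem {R A : Type*} [CommRing R] [CommRing A] [Algebra R A] {m : ℕ} {ι : Type*}
    {Γ : Subalgebra R A} {D : Fin m → Derivation ℤ A A} (hD : ∀ i, ∀ a ∈ Γ, D i a ∈ Γ)
    {z : ι → A} (hz : ∀ k, z k ∈ Γ) (p : DPoly R m ι) : evalD D z p ∈ Γ := by
  induction p using MvPolynomial.induction_on with
  | C c => exact evalD_C D z c ▸ Γ.algebraMap_mem c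
  | add p q hp hq => exact map_add (evalD D z) p q ▸ Γ.add_mem hp hq
  | mul_X p kα hp =>
    rw [map_mul, evalD_X]
    exact Γ.mul_mem hp (jetOp_induction hD kα.2 (hz kα.1))

/-- The derivation of a product of rings that acts componentwise. -/
def prodD {A B : Type*} [CommRing A] [CommRing B] (D : Derivation ℤ A A)
    (E : Derivation ℤ B B) : Der (A × B) :=
  Derivation.mk'
    (AddMonoidHom.toIntLinearMap
      { toFun := fun x => (D x.1, E x.2)
        map_zero' := by simp
        map_add' := fun x y => by simp })
    (fun x y => by ext <;> simp)

theorem formalD_comm {R ι : Type*} [CommRing R] {m : ℕ} (i j : Fin m) (p : DPoly R m ι) :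
    formalD R ι i (formalD R ι j p) = formalD R ι j (formalD R ι i p) := by
  have h : ⁅formalD R ι i, formalD R ι j⁆ = 0 := MvPolynomial.derivation_ext fun kα => by
    simp [Derivation.commutator_apply, formalD, MvPolynomial.mkDerivation_X, add_right_comm]
  rw [← sub_eq_zero, ← Derivation.commutator_apply, h, Derivation.zero_apply]

section Values

variable {F : Type u} [Field F] {m : ℕ} {d δ : Fin m → Derivation ℤ F F} {ι κ : Type*}
  {S : (Fin m → Derivation ℤ F F) → Set (ι → F)} {z : ι → F}

theorem toFun_one : toFun d S 1 = 1 := by simp [toFun]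

theorem toFun_add (p q : DPoly (constants d) m ι) :
    toFun d S (p + q) = toFun d S p + toFun d S q := by simp [toFun]

theorem toFun_sub (p q : DPoly (constants d) m ι) :
    toFun d S (p - q) = toFun d S p - toFun d S q := by simp [toFun]

theorem toFun_mul (p q : DPoly (constants d) m ι) :
    toFun d S (p * q) = toFun d S p * toFun d S q := by simp [toFun]

theorem toFun_eq_zero {p : DPoly (constants d) m ι} :
    toFun d S p = 0 ↔ p ∈ vanishingIdeal d S := by
  rw [toFun, IsFractionRing.to_map_eq_zero_iff, toCoord_eq_zero]

theorem evalD_eq_of_toFun_eq {p q : DPoly (constants d) m ι} (h : toFun d S p = toFun d S q)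
    (hδ : δ ∈ base d) (hz : z ∈ S δ) : evalD δ z p = evalD δ z q := by
  have hpq := toFun_eq_zero.1 ((toFun_sub p q).trans (sub_eq_zero.2 h)) δ hδ z hz
  rwa [map_sub, sub_eq_zero] at hpq

theorem HasValue.unique (hδ : δ ∈ base d) (hz : z ∈ S δ) {f : FunField d S} {a b : F}
    (ha : HasValue f δ z a) (hb : HasValue f δ z b) : a = b := by
  obtain ⟨r, s, h, hs, ha⟩ := ha
  obtain ⟨r', s', h', hs', hb⟩ := hb
  have hcross : toFun d S (r * s') = toFun d S (r' * s) := by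
    rw [toFun_mul, toFun_mul, ← h, ← h', mul_right_comm]
  have hval := evalD_eq_of_toFun_eq hcross hδ hz
  rw [map_mul, map_mul, ← ha, ← hb, mul_right_comm] at hval
  exact mul_right_cancel₀ hs'.ne_zero (mul_right_cancel₀ hs.ne_zero hval)

theorem hasValue_toFun (δ : Fin m → Derivation ℤ F F) (z : ι → F)
    (p : DPoly (constants d) m ι) : HasValue (toFun d S p) δ z (evalD δ z p) :=
  ⟨p, 1, by rw [toFun_one, mul_one], by simp, by simp⟩

theorem hasValue_coord (δ : Fin m → Derivation ℤ F F) (z : ι → F) (k : ι) :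
    HasValue (coord d S k) δ z (z k) := by
  have h := hasValue_toFun (d := d) (S := S) δ z (MvPolynomial.X (k, 0))
  rw [evalD_X, jetOp_zero] at h
  exact h

theorem HasValue.add {f g : FunField d S} {a b : F} (ha : HasValue f δ z a)
    (hb : HasValue g δ z b) : HasValue (f + g) δ z (a + b) := by
  obtain ⟨r, s, h, hs, ha⟩ := ha
  obtain ⟨r', s', h', hs', hb⟩ := hb
  refine ⟨r * s' + r' * s, s * s', ?_, map_mul (evalD δ z) s s' ▸ hs.mul hs', ?_⟩
  · rw [toFun_add, toFun_mul, toFun_mul, toFun_mul, ← h, ← h']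
    ring
  · rw [map_mul, map_add, map_mul, map_mul, ← ha, ← hb]
    ring

theorem HasValue.mul {f g : FunField d S} {a b : F} (ha : HasValue f δ z a)
    (hb : HasValue g δ z b) : HasValue (f * g) δ z (a * b) := by
  obtain ⟨r, s, h, hs, ha⟩ := ha
  obtain ⟨r', s', h', hs', hb⟩ := hb
  refine ⟨r * r', s * s', ?_, map_mul (evalD δ z) s s' ▸ hs.mul hs', ?_⟩
  · rw [toFun_mul, toFun_mul, ← h, ← h', mul_mul_mul_comm]
  · rw [map_mul, map_mul, ← ha, ← hb, mul_mul_mul_comm]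

theorem HasValue.of_mul_eq {f g e : FunField d S} {a b : F} (h : f * g = e)
    (hg : HasValue g δ z a) (ha : a ≠ 0) (he : HasValue e δ z b) : HasValue f δ z (b / a) := by
  obtain ⟨r₁, s₁, h₁, hs₁, h₁a⟩ := hg
  obtain ⟨r₂, s₂, h₂, hs₂, h₂b⟩ := he
  refine ⟨r₂ * s₁, r₁ * s₂, ?_, ?_, ?_⟩
  · rw [toFun_mul, toFun_mul, ← h₁, ← h₂, ← h]
    ring
  · rw [map_mul, ← h₁a]
    exact ((isUnit_iff_ne_zero.2 ha).mul hs₁).mul hs₂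
  · rw [map_mul, map_mul, ← h₁a, ← h₂b]
    field_simp

theorem HasValue.derivation (hd : Commuting d) (hδ : δ ∈ base d) {f : FunField d S} {a : F}
    (ha : HasValue f δ z a) (i : Fin m) : HasValue (funD hd S i f) δ z (δ i a) := by
  obtain ⟨r, s, h, hs, ha⟩ := ha
  have hf := congrArg (funD hd S i) h
  have hval := congrArg (δ i) ha
  rw [Derivation.leibniz, smul_eq_mul, smul_eq_mul, funD_toFun, funD_toFun] at hf
  rw [Derivation.leibniz, smul_eq_mul, smul_eq_mul,
    ← evalD_formalD (commuting_of_mem_base hd hδ) (base_const hδ),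
    ← evalD_formalD (commuting_of_mem_base hd hδ) (base_const hδ)] at hval
  refine ⟨formalD _ ι i r * s - r * formalD _ ι i s, s * s, ?_,
    map_mul (evalD δ z) s s ▸ hs.mul hs, ?_⟩
  · rw [toFun_sub, toFun_mul, toFun_mul, toFun_mul, ← hf, ← h]
    ring
  · rw [map_sub, map_mul, map_mul, map_mul, ← hval, ← ha]
    ring

variable (d S) in
/-- The graph of the partially defined map that takes a differential rational function to its
value at a given point. -/
def valueGraph (δ : Fin m → Derivation ℤ F F) (z : ι → F) :
    Subalgebra (constants d) (FunField d S × F) where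
  carrier := {x | HasValue x.1 δ z x.2}
  mul_mem' := HasValue.mul
  add_mem' := HasValue.add
  algebraMap_mem' c := by
    have h := hasValue_toFun (S := S) δ z (MvPolynomial.C c)
    rw [evalD_C] at h
    exact h

theorem HasValue.sub {f g : FunField d S} {a b : F} (ha : HasValue f δ z a)
    (hb : HasValue g δ z b) : HasValue (f - g) δ z (a - b) :=
  (valueGraph d S δ z).sub_mem (x := (f, a)) (y := (g, b)) ha hb

theorem HasValue.ne_zero (hδ : δ ∈ base d) (hz : z ∈ S δ) {f : FunField d S} {a : F}
    (ha : HasValue f δ z a) (ha0 : a ≠ 0) : f ≠ 0 := by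
  rintro rfl
  exact ha0 (ha.unique hδ hz (valueGraph d S δ z).zero_mem)

theorem HasValue.sum (t : Finset κ) {f : κ → FunField d S} {a : κ → F}
    (h : ∀ k, HasValue (f k) δ z (a k)) : HasValue (∑ k ∈ t, f k) δ z (∑ k ∈ t, a k) := by
  have hmem := (valueGraph d S δ z).sum_mem (t := t) (f := fun k => (f k, a k)) fun k _ => h k
  have hsum : (∑ k ∈ t, (f k, a k)) = (∑ k ∈ t, f k, ∑ k ∈ t, a k) :=
    Prod.ext Prod.fst_sum Prod.snd_sum
  rwa [hsum] at hmem

theorem HasValue.evalD {δ' : Fin m → Derivation ℤ F F}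
    {D : Fin m → Derivation ℤ (FunField d S) (FunField d S)}
    (hD : ∀ i f a, HasValue f δ z a → HasValue (D i f) δ z (δ' i a))
    {w : κ → FunField d S} {y : κ → F} (hw : ∀ k, HasValue (w k) δ z (y k))
    (p : DPoly (constants d) m κ) : HasValue (evalD D w p) δ z (evalD δ' y p) := by
  have hmem : DiffInv.evalD (fun i => prodD (D i) (δ' i)) (fun k => (w k, y k)) p ∈
      valueGraph d S δ z :=
    evalD_mem (fun i x hx => hD i x.1 x.2 hx) hw p
  have hfst := map_evalD (D := fun i => prodD (D i) (δ' i)) (D' := D)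
    (AlgHom.fst (constants d) (FunField d S) F) (fun i x => rfl) (fun k => (w k, y k)) p
  have hsnd := map_evalD (D := fun i => prodD (D i) (δ' i)) (D' := δ')
    (AlgHom.snd (constants d) (FunField d S) F) (fun i x => rfl) (fun k => (w k, y k)) p
  rw [AlgHom.fst_apply] at hfst
  rw [AlgHom.snd_apply] at hsnd
  exact hfst ▸ hsnd ▸ hmem

section Matrix

variable [Fintype κ] [DecidableEq κ] {p : Matrix κ κ (FunField d S)}

theorem HasValue.det {P : Matrix κ κ F} (h : ∀ i j, HasValue (p i j) δ z (P i j)) :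
    HasValue p.det δ z P.det := by
  let N : Matrix κ κ (valueGraph d S δ z) := Matrix.of fun i j => ⟨(p i j, P i j), h i j⟩
  have hfst : N.det.1.1 = p.det :=
    ((AlgHom.fst (constants d) _ F).comp (valueGraph d S δ z).val).map_det N
  have hsnd : N.det.1.2 = P.det :=
    ((AlgHom.snd (constants d) (FunField d S) F).comp (valueGraph d S δ z).val).map_det N
  exact hfst ▸ hsnd ▸ N.det.2

theorem HasValue.adjugate {P : Matrix κ κ F} (h : ∀ i j, HasValue (p i j) δ z (P i j))
    (i j : κ) : HasValue (p.adjugate i j) δ z (P.adjugate i j) := by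
  let N : Matrix κ κ (valueGraph d S δ z) := Matrix.of fun i j => ⟨(p i j, P i j), h i j⟩
  have hfst := congrFun₂
    (((AlgHom.fst (constants d) _ F).comp (valueGraph d S δ z).val).map_adjugate N) i j
  have hsnd := congrFun₂ (((AlgHom.snd (constants d) (FunField d S) F).comp
    (valueGraph d S δ z).val).map_adjugate N) i j
  exact Eq.subst (motive := fun x => HasValue x δ z _) hfst
    (Eq.subst (motive := fun x => HasValue _ δ z x) hsnd (N.adjugate i j).2)

theorem HasValue.matrix_inv {P : GL κ F} (hp : IsUnit p)
    (h : ∀ i j, HasValue (p i j) δ z (P i j)) (i j : κ) :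
    HasValue (p⁻¹ i j) δ z ((P⁻¹ : GL κ F) i j) := by
  have hdet : IsUnit p.det := (Matrix.isUnit_iff_isUnit_det p).1 hp
  have hP : P.val.det ≠ 0 := ((Matrix.isUnit_iff_isUnit_det P.val).1 P.isUnit).ne_zero
  have hmul : p⁻¹ i j * p.det = p.adjugate i j := by
    rw [Matrix.inv_def, Matrix.smul_apply, smul_eq_mul, mul_right_comm,
      Ring.inverse_mul_cancel _ hdet, one_mul]
  have hPinv : (P⁻¹ : GL κ F) i j = P.val.adjugate i j / P.val.det := by
    rw [Matrix.coe_units_inv, Matrix.inv_def, Matrix.smul_apply, smul_eq_mul,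
      Ring.inverse_eq_inv', div_eq_inv_mul]
  exact hPinv ▸ HasValue.of_mul_eq hmul (HasValue.det h) hP (HasValue.adjugate h i j)

end Matrix

theorem HasValue.combo (hd : Commuting d) (hδ : δ ∈ base d)
    {p : Matrix (Fin m) (Fin m) (FunField d S)} (hp : IsUnit p) {g : GL (Fin m) F}
    (hg : ∀ i j, HasValue (p i j) δ z (g i j)) (i : Fin m) {f : FunField d S} {a : F}
    (ha : HasValue f δ z a) : HasValue (combo p⁻¹ (funD hd S) i f) δ z (act g δ i a) := by
  rw [act, combo_apply, combo_apply]
  exact HasValue.sum _ fun j => (HasValue.matrix_inv hp hg i j).mul (ha.derivation hd hδ j)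

theorem algebraMap_constants (c : constants d) :
    algebraMap (constants d) (FunField d S) c = toFun d S (MvPolynomial.C c) :=
  rfl

theorem combo_funD_algebraMap (hd : Commuting d) (M : Matrix (Fin m) (Fin m) (FunField d S))
    (i : Fin m) (c : constants d) :
    combo M (funD hd S) i (algebraMap (constants d) (FunField d S) c) = 0 := by
  rw [algebraMap_constants, combo_apply]
  refine Finset.sum_eq_zero fun j _ => ?_
  rw [funD_toFun, ← MvPolynomial.algebraMap_eq, Derivation.map_algebraMap, toFun, map_zero,
    map_zero, mul_zero]

theorem exists_toFun_eq (f : FunField d S) :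
    ∃ r s, f * toFun d S s = toFun d S r ∧ IsUnit (toFun d S s) := by
  obtain ⟨⟨a, b⟩, h⟩ := IsLocalization.surj (nonZeroDivisors (CoordRing d S)) f
  have hb := IsLocalization.map_units (FunField d S) b
  obtain ⟨r, rfl⟩ := toCoord_surjective d S a
  obtain ⟨s, hs⟩ := toCoord_surjective d S b
  rw [← hs] at h hb
  exact ⟨r, s, h, hb⟩

theorem commuting_funD (hd : Commuting d) (S : (Fin m → Derivation ℤ F F) → Set (ι → F)) :
    Commuting (funD hd S) := by
  refine commuting_fracD (D := coordD hd S) fun i j a => ?_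
  obtain ⟨p, rfl⟩ := toCoord_surjective d S a
  simp only [coordD, quotD_apply, formalD_comm i j p]

end Values

/-! ### The fibres of the groupoid -/

/-- The unknowns `h i j` and `y k` that parametrize `GL(n, F) × GL^δ(m, F)` by
`(h, y) ↦ (h, δ y)`. -/
abbrev GroupIdx (n m : ℕ) : Type := (Fin n × Fin n) ⊕ Fin m

/-- The matrix of the unknowns `h i j`. -/
def genericLeft (R : Type*) [CommRing R] (n m : ℕ) :
    Matrix (Fin n) (Fin n) (DPoly R m (GroupIdx n m)) :=
  Matrix.of fun i j => MvPolynomial.X (Sum.inl (i, j), 0)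

/-- The Jacobian matrix of the vector of the unknowns `y k`. -/
def genericRight (R : Type*) [CommRing R] (n m : ℕ) :
    Matrix (Fin m) (Fin m) (DPoly R m (GroupIdx n m)) :=
  Matrix.of fun i k => MvPolynomial.X (Sum.inr k, Pi.single i 1)

/-- The point of the parameter space of `GL(n) × GL^δ(m)` with the components `h` and `y`. -/
def groupPoint {A : Type*} {n m : ℕ} (h : Matrix (Fin n) (Fin n) A) (y : Fin m → A) :
    GroupIdx n m → A :=
  Sum.elim (fun ij => h ij.1 ij.2) y

theorem exists_eq_groupPoint {A : Type*} {n m : ℕ} (x : GroupIdx n m → A) :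
    ∃ h y, x = groupPoint h y :=
  ⟨Matrix.of fun i j => x (Sum.inl (i, j)), x ∘ Sum.inr, (Sum.elim_comp_inl_inr x).symm⟩

theorem map_triple {A B : Type*} {n m l : ℕ} (φ : A → B) (h : Matrix (Fin n) (Fin n) A)
    (g : Matrix (Fin m) (Fin m) A) (v : Fin l → A) :
    (fun k => φ (triple h g v k)) = triple (h.map φ) (g.map φ) fun k => φ (v k) := by
  funext k
  rcases k with k | k | k <;> rfl

/-- The restriction of a differential polynomial in `(h, g, v)` to the triples `(h, δ y, x)` with
a fixed `x`. -/
def restrictToGroup {C R : Type*} [CommRing C] [CommRing R] [Algebra C R] {m n l : ℕ}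
    (δ : Fin m → Derivation ℤ R R) (x : Fin l → R) (p : DPoly C m (TripleIdx n m l)) :
    DPoly R m (GroupIdx n m) :=
  evalD (extD δ (GroupIdx n m))
    (triple (genericLeft R n m) (genericRight R n m) fun k => MvPolynomial.C (x k)) p

theorem map_restrictToGroup {C R R' : Type*} [CommRing C] [CommRing R] [CommRing R']
    [Algebra C R] [Algebra C R'] {m n l : ℕ} {δ : Fin m → Derivation ℤ R R}
    {δ' : Fin m → Derivation ℤ R' R'} (ψ : R →ₐ[C] R')
    (hψ : ∀ i a, ψ (δ i a) = δ' i (ψ a)) (x : Fin l → R) (p : DPoly C m (TripleIdx n m l)) :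
    MvPolynomial.map ψ.toRingHom (restrictToGroup δ x p) =
      restrictToGroup δ' (fun k => ψ (x k)) p := by
  have h := map_evalD (D' := extD δ' (GroupIdx n m)) (MvPolynomial.mapAlgHom ψ)
    (fun i a => map_extD (δ := δ) (δ' := δ') ψ.toRingHom hψ i a)
    (triple (genericLeft R n m) (genericRight R n m) fun k => MvPolynomial.C (x k)) p
  rw [map_triple] at h
  have hleft : (genericLeft R n m).map (MvPolynomial.mapAlgHom ψ) = genericLeft R' n m :=
    Matrix.ext fun i j => MvPolynomial.map_X _ _
  have hright : (genericRight R n m).map (MvPolynomial.mapAlgHom ψ) = genericRight R' n m :=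
    Matrix.ext fun i j => MvPolynomial.map_X _ _
  have hpoint (k : Fin l) : MvPolynomial.mapAlgHom (σ := GroupIdx n m × (Fin m → ℕ)) ψ
      (MvPolynomial.C (x k)) = MvPolynomial.C (ψ (x k)) := MvPolynomial.map_C _ _
  simp only [hleft, hright, hpoint] at h
  exact h

/-- The coefficient at `μ` of the restriction of `p` to `(h, δ y, x)`, as a differential
polynomial in `x`. -/
def groupCoeff {C : Type*} [CommRing C] {m n l : ℕ} (μ : (GroupIdx n m × (Fin m → ℕ)) →₀ ℕ)
    (p : DPoly C m (TripleIdx n m l)) : DPoly C m (Fin l) :=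
  (restrictToGroup (extD (0 : Fin m → Derivation ℤ C C) (Fin l))
    (fun k => MvPolynomial.X (k, 0)) p).coeff μ

section Field

variable {F : Type u} [Field F] {m n l : ℕ} {d δ : Fin m → Derivation ℤ F F} {C : Type*}
  [CommRing C] [Algebra C F]

theorem coeff_restrictToGroup (hδ : Commuting δ) (hC : ∀ i (c : C), δ i (algebraMap C F c) = 0)
    (μ : (GroupIdx n m × (Fin m → ℕ)) →₀ ℕ) (y : Fin l → F) (p : DPoly C m (TripleIdx n m l)) :
    (restrictToGroup δ y p).coeff μ = evalD δ y (groupCoeff μ p) := by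
  have hderiv (i : Fin m) (a : DPoly C m (Fin l)) :
      evalD δ y (extD (0 : Fin m → Derivation ℤ C C) (Fin l) i a) = δ i (evalD δ y a) :=
    evalD_extD hδ (fun i c => (hC i c).trans (map_zero _).symm) y i a
  have h := map_restrictToGroup (evalD δ y) hderiv (fun k => MvPolynomial.X (k, 0)) p
  simp only [evalD_X, jetOp_zero] at h
  rw [groupCoeff, ← h, MvPolynomial.coeff_map]
  rfl

theorem genericLeft_evalD (δ : Fin m → Derivation ℤ F F) (h : Matrix (Fin n) (Fin n) F)
    (y : Fin m → F) : (genericLeft F n m).map (evalD (R := F) δ (groupPoint h y)) = h := by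
  ext i j
  simp [genericLeft, jetOp_zero, groupPoint]

theorem genericRight_evalD (hδ : Commuting δ) (h : Matrix (Fin n) (Fin n) F) (y : Fin m → F) :
    (genericRight F n m).map (evalD (R := F) δ (groupPoint h y)) = jacobian δ y := by
  ext i j
  simp [genericRight, jetOp_single hδ, groupPoint, jacobian]

theorem evalD_restrictToGroup (hδ : Commuting δ) (h : Matrix (Fin n) (Fin n) F)
    (y : Fin m → F) (v : Fin l → F) (p : DPoly C m (TripleIdx n m l)) :
    evalD δ (groupPoint h y) (restrictToGroup δ v p) =
      evalD δ (triple h (jacobian δ y) v) p := by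
  rw [restrictToGroup, evalD_evalD hδ fun _ _ => rfl, map_triple, genericLeft_evalD,
    genericRight_evalD hδ]
  simp only [evalD_C, Algebra.algebraMap_self, RingHom.id_apply]

theorem restrictToGroup_ne_zero (hδ : Commuting δ) (hF : IsDiffClosed δ) {h : GL (Fin n) F}
    {g : GL (Fin m) F} (hg : g ∈ intGL δ) {v : Fin l → F} {p : DPoly C m (TripleIdx n m l)}
    (hp : evalD δ (triple h.val g.val v) p ≠ 0) : restrictToGroup δ v p ≠ 0 := by
  obtain ⟨y, hy⟩ := hF.exists_jacobian_eq hδ hg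
  rw [← hy, ← evalD_restrictToGroup hδ] at hp
  exact ne_zero_of_map hp

theorem exists_group_point (hδ : Commuting δ) (hF : IsDiffClosed δ)
    {q : DPoly F m (GroupIdx n m)} (hq : q ≠ 0) :
    ∃ (h : GL (Fin n) F) (g : GL (Fin m) F) (y : Fin m → F), g ∈ intGL δ ∧
      g.val = jacobian δ y ∧ evalD δ (groupPoint h.val y) q ≠ 0 := by
  have hleft (h : Matrix (Fin n) (Fin n) F) (y : Fin m → F) :
      evalD (R := F) δ (groupPoint h y) (genericLeft F n m).det = h.det := by
    rw [AlgHom.map_det, AlgHom.mapMatrix_apply, genericLeft_evalD]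
  have hright (h : Matrix (Fin n) (Fin n) F) (y : Fin m → F) :
      evalD (R := F) δ (groupPoint h y) (genericRight F n m).det = (jacobian δ y).det := by
    rw [AlgHom.map_det, AlgHom.mapMatrix_apply, genericRight_evalD hδ]
  obtain ⟨y₁, hy₁⟩ := hF.exists_jacobian_eq hδ (one_mem_intGL δ)
  have hleft0 : (genericLeft F n m).det ≠ 0 :=
    ne_zero_of_map ((hleft 1 0).trans_ne (Matrix.det_one.trans_ne one_ne_zero))
  have hright0 : (genericRight F n m).det ≠ 0 := ne_zero_of_map
    ((hright 1 y₁).trans_ne (hy₁ ▸ Matrix.det_one.trans_ne one_ne_zero))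
  obtain ⟨x, hx⟩ := hF.exists_evalD_ne_zero hδ (mul_ne_zero (mul_ne_zero hq hleft0) hright0)
  obtain ⟨h, y, rfl⟩ := exists_eq_groupPoint x
  rw [map_mul, map_mul, hleft, hright, mul_ne_zero_iff, mul_ne_zero_iff] at hx
  exact ⟨.mkOfDetNeZero h hx.1.2, .mkOfDetNeZero (jacobian δ y) hx.2, y,
    fun i j k => hδ i j (y k), rfl, hx.1.1⟩

theorem isOpen_evalD_ne_zero {ι : Type*} (δ : Fin m → Derivation ℤ F F) (p : DPoly C m ι) :
    @IsOpen _ (kolchin δ ι) {z | evalD δ z p ≠ 0} := by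
  change {z | evalD δ z p ≠ 0}ᶜ ∈ Set.range _
  refine ⟨{MvPolynomial.map (algebraMap C F) p}, ?_⟩
  ext z
  simp [zeros, evalD, MvPolynomial.aeval_def]

theorem exists_evalD_ne_zero_of_mem_closure {ι : Type*} {S : Set (ι → F)} {z : ι → F}
    (hz : z ∈ @closure _ (kolchin δ ι) S) {p : DPoly C m ι} (hp : evalD δ z p ≠ 0) :
    ∃ v ∈ S, evalD δ v p ≠ 0 := by
  let := kolchin δ ι
  obtain ⟨v, hv, hvS⟩ := mem_closure_iff.1 hz _ (isOpen_evalD_ne_zero δ p) hp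
  exact ⟨v, hvS, hv⟩

theorem exists_evalD_ne_zero_of_isIrreducible {ι : Type*} {W W₀ : Set (ι → F)}
    (hW : @IsIrreducible _ (kolchin δ ι) W) (hW₀ : W ⊆ @closure _ (kolchin δ ι) W₀)
    {p q : DPoly C m ι} {v₁ v₂ : ι → F} (hv₁ : v₁ ∈ W) (hv₂ : v₂ ∈ W)
    (hp : evalD δ v₁ p ≠ 0) (hq : evalD δ v₂ q ≠ 0) :
    ∃ v ∈ W₀, evalD δ v p ≠ 0 ∧ evalD δ v q ≠ 0 := by
  let := kolchin δ ι
  obtain ⟨v, hvW, hv⟩ := hW.2 _ _ (isOpen_evalD_ne_zero δ p) (isOpen_evalD_ne_zero δ q)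
    ⟨v₁, hv₁, hp⟩ ⟨v₂, hv₂, hq⟩
  rw [Set.mem_inter_iff, Set.mem_ofPred_eq, Set.mem_ofPred_eq, ← mul_ne_zero_iff,
    ← map_mul] at hv
  obtain ⟨u, huW₀, hu⟩ := exists_evalD_ne_zero_of_mem_closure (hW₀ hvW) hv
  rw [map_mul, mul_ne_zero_iff] at hu
  exact ⟨u, huW₀, hu⟩

/-- The restriction of a differential polynomial in `(h, g, v)` to fixed `h` and `g`. -/
def restrictToPoint (δ : Fin m → Derivation ℤ F F) (h : Matrix (Fin n) (Fin n) F)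
    (g : Matrix (Fin m) (Fin m) F) (p : DPoly C m (TripleIdx n m l)) : DPoly F m (Fin l) :=
  evalD (extD δ (Fin l)) (triple (h.map MvPolynomial.C) (g.map MvPolynomial.C)
    fun k => MvPolynomial.X (k, 0)) p

theorem evalD_restrictToPoint (hδ : Commuting δ) (h : Matrix (Fin n) (Fin n) F)
    (g : Matrix (Fin m) (Fin m) F) (v : Fin l → F) (p : DPoly C m (TripleIdx n m l)) :
    evalD δ v (restrictToPoint δ h g p) = evalD δ (triple h g v) p := by
  have hmap {k : ℕ} (M : Matrix (Fin k) (Fin k) F) :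
      (M.map MvPolynomial.C).map (evalD (R := F) δ v) = M :=
    Matrix.ext fun i j => evalD_C δ v (M i j)
  rw [restrictToPoint, evalD_evalD hδ fun _ _ => rfl, map_triple, hmap, hmap]
  simp only [evalD_X, jetOp_zero]

/-- The fibre `GL(n, F) × GL^δ(m, F) × W` of the groupoid is irreducible, and its points over a
dense subset of `W` are dense. -/
theorem exists_generic_arrow (hδ : Commuting δ) (hF : IsDiffClosed δ) {W W₀ : Set (Fin l → F)}
    (hW : @IsIrreducible _ (kolchin δ (Fin l)) W)
    (hW₀ : W ⊆ @closure _ (kolchin δ (Fin l)) W₀)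
    {p q : DPoly C m (TripleIdx n m l)} {h₁ h₂ : GL (Fin n) F} {g₁ g₂ : GL (Fin m) F}
    {v₁ v₂ : Fin l → F} (hg₁ : g₁ ∈ intGL δ) (hg₂ : g₂ ∈ intGL δ) (hv₁ : v₁ ∈ W) (hv₂ : v₂ ∈ W)
    (hp : evalD δ (triple h₁.val g₁.val v₁) p ≠ 0)
    (hq : evalD δ (triple h₂.val g₂.val v₂) q ≠ 0) :
    ∃ (h : GL (Fin n) F) (g : GL (Fin m) F), g ∈ intGL δ ∧ ∃ v ∈ W₀,
      evalD δ (triple h.val g.val v) p ≠ 0 ∧ evalD δ (triple h.val g.val v) q ≠ 0 := by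
  obtain ⟨h, g, y, hg, hgy, hy⟩ := exists_group_point hδ hF (mul_ne_zero
    (restrictToGroup_ne_zero hδ hF hg₁ hp) (restrictToGroup_ne_zero hδ hF hg₂ hq))
  rw [map_mul, evalD_restrictToGroup hδ, evalD_restrictToGroup hδ, ← hgy,
    ← evalD_restrictToPoint hδ, ← evalD_restrictToPoint hδ, mul_ne_zero_iff] at hy
  obtain ⟨v, hv, hvp, hvq⟩ := exists_evalD_ne_zero_of_isIrreducible hW hW₀ hv₁ hv₂ hy.1 hy.2
  rw [evalD_restrictToPoint hδ] at hvp hvq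
  exact ⟨h, g, hg, v, hv, hvp, hvq⟩

end Field

section Density

variable {F : Type u} [Field F] {m : ℕ} {d : Fin m → Derivation ℤ F F} {ι : Type*}
  {S S₀ : (Fin m → Derivation ℤ F F) → Set (ι → F)}
  (hS₀ : ∀ δ ∈ base d, S δ ⊆ @closure _ (kolchin δ ι) (S₀ δ))
include hS₀

theorem toFun_eq_zero_of_dense {p : DPoly (constants d) m ι}
    (hp : ∀ δ ∈ base d, ∀ z ∈ S₀ δ, evalD δ z p = 0) : toFun d S p = 0 := by
  refine toFun_eq_zero.2 fun δ hδ z hz => ?_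
  by_contra hne
  obtain ⟨v, hv, hvp⟩ := exists_evalD_ne_zero_of_mem_closure (hS₀ δ hδ hz) hne
  exact hvp (hp δ hδ v hv)

theorem eq_zero_of_forall_hasValue {f : FunField d S}
    (hf : ∀ δ ∈ base d, ∀ z ∈ S₀ δ, ∀ a, HasValue f δ z a → a = 0) : f = 0 := by
  obtain ⟨r, s, hrs, hs⟩ := exists_toFun_eq f
  have hzero : toFun d S (r * s) = 0 := by
    refine toFun_eq_zero_of_dense hS₀ fun δ hδ z hz => ?_
    rw [map_mul, mul_eq_zero, or_iff_not_imp_right]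
    intro hsz
    have hval := hf δ hδ z hz (evalD δ z r / evalD δ z s)
      ⟨r, s, hrs, isUnit_iff_ne_zero.2 hsz, div_mul_cancel₀ _ hsz⟩
    exact (div_eq_zero_iff.1 hval).resolve_right hsz
  rw [toFun_mul, ← hrs, mul_assoc] at hzero
  exact (hs.mul hs).mul_left_eq_zero.1 hzero

theorem eq_of_forall_hasValue (hsub : ∀ δ ∈ base d, S₀ δ ⊆ S δ) {f g : FunField d S}
    (h : ∀ δ ∈ base d, ∀ z ∈ S₀ δ, ∃ a, HasValue f δ z a ∧ HasValue g δ z a) : f = g := by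
  refine sub_eq_zero.1 (eq_zero_of_forall_hasValue hS₀ fun δ hδ z hz a ha => ?_)
  obtain ⟨b, hf, hg⟩ := h δ hδ z hz
  exact (ha.unique hδ (hsub δ hδ hz) (hf.sub hg)).trans (sub_self b)

theorem isUnit_of_forall_hasValue (hsub : ∀ δ ∈ base d, S₀ δ ⊆ S δ) {f : FunField d S}
    (hf : ∀ δ ∈ base d, ∀ z ∈ S₀ δ, ∃ a ≠ 0, HasValue f δ z a) : IsUnit f := by
  have hregular (q : DPoly (constants d) m ι) (hq : f * toFun d S q = 0) : toFun d S q = 0 := by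
    refine toFun_eq_zero_of_dense hS₀ fun δ hδ z hz => ?_
    obtain ⟨a, ha0, ha⟩ := hf δ hδ z hz
    by_contra hne
    exact (ha.mul (hasValue_toFun δ z q)).ne_zero hδ (hsub δ hδ hz) (mul_ne_zero ha0 hne) hq
  obtain ⟨r, s, hrs, hs⟩ := exists_toFun_eq f
  have hr : toCoord d S r ∈ nonZeroDivisors (CoordRing d S) := by
    refine mem_nonZeroDivisors_iff_right.2 fun b hb => ?_
    obtain ⟨q, rfl⟩ := toCoord_surjective d S b
    rw [← map_mul, toCoord_eq_zero, ← toFun_eq_zero, toFun_mul, ← hrs, ← mul_assoc] at hb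
    rw [toCoord_eq_zero, ← toFun_eq_zero]
    refine hregular q (hs.mul_left_eq_zero.1 ?_)
    rw [← hb]
    ring
  have hunit : IsUnit (toFun d S r) := IsLocalization.map_units (FunField d S) ⟨_, hr⟩
  exact isUnit_of_mul_isUnit_left (hrs ▸ hunit)

end Density

theorem exists_evalD_ne_zero_of_hasValue {F : Type u} [Field F] {m : ℕ}
    {d δ : Fin m → Derivation ℤ F F} {ι : Type*}
    {S : (Fin m → Derivation ℤ F F) → Set (ι → F)} {z : ι → F} {f : FunField d S} {a : F}
    (ha : HasValue f δ z a) (ha0 : a ≠ 0) : ∃ q : DPoly (constants d) m ι, evalD δ z q ≠ 0 ∧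
      ∀ (δ' : Fin m → Derivation ℤ F F) (z' : ι → F), evalD δ' z' q ≠ 0 →
        ∃ b ≠ 0, HasValue f δ' z' b := by
  obtain ⟨r, s, hrs, hs, har⟩ := ha
  refine ⟨r * s, ?_, fun δ' z' h => ?_⟩
  · rw [map_mul, ← har]
    exact mul_ne_zero (mul_ne_zero ha0 hs.ne_zero) hs.ne_zero
  · rw [map_mul, mul_ne_zero_iff] at h
    exact ⟨evalD δ' z' r / evalD δ' z' s, div_ne_zero h.1 h.2,
      r, s, hrs, isUnit_iff_ne_zero.2 h.2, div_mul_cancel₀ _ h.2⟩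

theorem exists_common_denominator {F : Type u} [Field F] {m : ℕ}
    {d δ : Fin m → Derivation ℤ F F} {ι : Type*}
    {S : (Fin m → Derivation ℤ F F) → Set (ι → F)} {z : ι → F} {f g : FunField d S} {a b : F}
    (ha : HasValue f δ z a) (hb : HasValue g δ z b) (hb0 : b ≠ 0) :
    ∃ p q e : DPoly (constants d) m ι, evalD δ z q ≠ 0 ∧
      f * toFun d S q = g * toFun d S p ∧ toFun d S q = g * toFun d S e := by
  obtain ⟨r, s, hrs, hs, -⟩ := ha
  obtain ⟨r', s', hrs', hs', hbr⟩ := hb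
  refine ⟨r * s', s * r', s * s', ?_, ?_, ?_⟩
  · rw [map_mul, ← hbr]
    exact mul_ne_zero hs.ne_zero (mul_ne_zero hb0 hs'.ne_zero)
  · rw [toFun_mul, toFun_mul, ← hrs, ← hrs']
    ring
  · rw [toFun_mul, toFun_mul, ← hrs']
    ring

/-! ### Arrows of the groupoid -/

section Groupoid

variable {F : Type u} [Field F] {l m n : ℕ}

/-- An arrow of the groupoid, acting on a point of the fibre of `W` over its source. -/
structure Arrow (d : Fin m → Derivation ℤ F F) (n : ℕ)
    (W : (Fin m → Derivation ℤ F F) → Set (Fin l → F)) where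
  src : Fin m → Derivation ℤ F F
  src_mem : src ∈ base d
  left : GL (Fin n) F
  right : GL (Fin m) F
  right_mem : right ∈ intGL src
  pt : Fin l → F
  pt_mem : pt ∈ W src

variable {d : Fin m → Derivation ℤ F F} {W : (Fin m → Derivation ℤ F F) → Set (Fin l → F)}

namespace Arrow

/-- The target of an arrow. -/
def tgt (x : Arrow d n W) : Fin m → Derivation ℤ F F := act x.right x.src

/-- The point of `G ⋄ W` given by an arrow. -/
def coords (x : Arrow d n W) : TripleIdx n m l → F := triple x.left.val x.right.val x.pt

/-- The image of the point of an arrow under the representation `τ`. -/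
def endpoint
    (τ : (Fin m → Derivation ℤ F F) → GL (Fin n) F → GL (Fin m) F → (Fin l → F) → (Fin l → F))
    (x : Arrow d n W) : Fin l → F :=
  τ x.src x.left x.right x.pt

theorem tgt_mem (x : Arrow d n W) : x.tgt ∈ base d := act_mem_base x.src_mem x.right_mem

theorem coords_mem (x : Arrow d n W) : x.coords ∈ diamond n W x.src :=
  ⟨x.left, x.right, x.pt, x.right_mem, x.pt_mem, rfl⟩

/-- The identity arrow at a point. -/
def id (n : ℕ) {δ : Fin m → Derivation ℤ F F} (hδ : δ ∈ base d) {v : Fin l → F}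
    (hv : v ∈ W δ) : Arrow d n W :=
  ⟨δ, hδ, 1, 1, one_mem_intGL δ, v, hv⟩

end Arrow

theorem exists_arrow_hasValue (hd : Commuting d) (hF : IsDiffClosed d)
    (hW : ∀ δ ∈ base d, @IsIrreducible _ (kolchin δ (Fin l)) (W δ))
    {W₀ : (Fin m → Derivation ℤ F F) → Set (Fin l → F)} (hsub : ∀ δ ∈ base d, W₀ δ ⊆ W δ)
    (hdense : ∀ δ ∈ base d, W δ ⊆ @closure _ (kolchin δ (Fin l)) (W₀ δ))
    {f g : FunField d (diamond n W)} {x y : Arrow d n W} (hxy : x.src = y.src) {a b : F}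
    (hf : HasValue f x.src x.coords a) (ha : a ≠ 0) (hg : HasValue g y.src y.coords b)
    (hb : b ≠ 0) : ∃ z : Arrow d n W, z.pt ∈ W₀ z.src ∧
      (∃ a ≠ 0, HasValue f z.src z.coords a) ∧ ∃ b ≠ 0, HasValue g z.src z.coords b := by
  obtain ⟨p, hp, hpf⟩ := exists_evalD_ne_zero_of_hasValue hf ha
  obtain ⟨q, hq, hqg⟩ := exists_evalD_ne_zero_of_hasValue hg hb
  obtain ⟨δ, hδ, h₁, g₁, hg₁, v₁, hv₁⟩ := x
  obtain ⟨δ', _, h₂, g₂, hg₂, v₂, hv₂⟩ := y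
  obtain rfl : δ = δ' := hxy
  obtain ⟨h, g, hg, v, hv, hvp, hvq⟩ := exists_generic_arrow (commuting_of_mem_base hd hδ)
    (isDiffClosed_of_mem_base hd hF hδ) (hW δ hδ) (hdense δ hδ) hg₁ hg₂ hv₁ hv₂ hp hq
  exact ⟨⟨δ, hδ, h, g, hg, v, hsub δ hδ hv⟩, hv, hpf _ _ hvp, hqg _ _ hvq⟩

variable (d n W) in
/-- The generic element of `GL^δ(m)`, as a matrix over `C⟨G ⋄ W⟩`. -/
def rightCoords : Matrix (Fin m) (Fin m) (FunField d (diamond n W)) :=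
  Matrix.of fun i j => coord d (diamond n W) (Sum.inr (Sum.inl (i, j)))

theorem hasValue_rightCoords (δ : Fin m → Derivation ℤ F F) (h : Matrix (Fin n) (Fin n) F)
    (g : Matrix (Fin m) (Fin m) F) (v : Fin l → F) (i j : Fin m) :
    HasValue (rightCoords n d W i j) δ (triple h g v) (g i j) :=
  hasValue_coord δ (triple h g v) (Sum.inr (Sum.inl (i, j)))

theorem isUnit_rightCoords : IsUnit (rightCoords n d W) := by
  rw [Matrix.isUnit_iff_isUnit_det]
  refine isUnit_of_forall_hasValue (S₀ := diamond n W)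
    (fun δ _ => @subset_closure _ (kolchin δ _) _) (fun _ _ => subset_rfl) ?_
  rintro δ - _ ⟨h, g, v, -, -, rfl⟩
  exact ⟨g.val.det, ((Matrix.isUnit_iff_isUnit_det _).1 g.isUnit).ne_zero,
    HasValue.det (hasValue_rightCoords δ h.val g.val v)⟩

variable (n W) in
/-- The function `(δ, h, g, v) ↦ p^δ⟨v⟩` on the arrows. -/
def sourcePullback (p : DPoly (constants d) m (Fin l)) : FunField d (diamond n W) :=
  toFun d (diamond n W) (renameD (Sum.inr ∘ Sum.inr) p)

theorem hasValue_sourcePullback (p : DPoly (constants d) m (Fin l)) (x : Arrow d n W) :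
    HasValue (sourcePullback n W p) x.src x.coords (evalD x.src x.pt p) := by
  have h := hasValue_toFun (d := d) (S := diamond n W) x.src x.coords
    (renameD (Sum.inr ∘ Sum.inr) p)
  rw [evalD_renameD] at h
  exact h

/-- The function `(δ, h, g, v) ↦ p^(g⁻¹δ)⟨τ^δ⟨h, g; v⟩⟩` on the arrows, where `T` is the vector
of the components of `τ`. -/
def targetPullback (hd : Commuting d) (T : Fin l → FunField d (diamond n W))
    (p : DPoly (constants d) m (Fin l)) : FunField d (diamond n W) :=
  evalD (combo (rightCoords n d W)⁻¹ (funD hd (diamond n W))) T p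

variable
  {τ : (Fin m → Derivation ℤ F F) → GL (Fin n) F → GL (Fin m) F → (Fin l → F) → (Fin l → F)}
  {T : Fin l → FunField d (diamond n W)}

variable (d W τ T) in
/-- `τ` is an algebraic representation of the groupoid on the family `W`, with the everywhere
defined differential rational functions `T k` as its components. -/
structure IsAlgebraicRep : Prop where
  hasValue : ∀ δ ∈ base d, ∀ (h : GL (Fin n) F), ∀ g ∈ intGL δ, ∀ v ∈ W δ, ∀ k,
    HasValue (T k) δ (triple h.val g.val v) (τ δ h g v k)
  mapsTo : ∀ δ ∈ base d, ∀ (h : GL (Fin n) F), ∀ g ∈ intGL δ, ∀ v ∈ W δ, τ δ h g v ∈ W (act g δ)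
  apply_one : ∀ δ ∈ base d, ∀ v ∈ W δ, τ δ 1 1 v = v
  apply_mul : ∀ δ ∈ base d, ∀ (h h₁ : GL (Fin n) F), ∀ g ∈ intGL δ, ∀ g₁ ∈ intGL (act g δ),
    ∀ v ∈ W δ, τ (act g δ) h₁ g₁ (τ δ h g v) = τ δ (h * h₁) (g * g₁) v

namespace IsAlgebraicRep

section

variable (hτ : IsAlgebraicRep d W τ T)
include hτ

theorem endpoint_mem (x : Arrow d n W) : x.endpoint τ ∈ W x.tgt :=
  hτ.mapsTo x.src x.src_mem x.left x.right x.right_mem x.pt x.pt_mem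

theorem hasValue_targetPullback (hd : Commuting d) (p : DPoly (constants d) m (Fin l))
    (x : Arrow d n W) :
    HasValue (targetPullback hd T p) x.src x.coords (evalD x.tgt (x.endpoint τ) p) :=
  HasValue.evalD
    (fun i _ _ ha => ha.combo hd x.src_mem isUnit_rightCoords
      (hasValue_rightCoords x.src x.left.val x.right.val x.pt) i)
    (hτ.hasValue x.src x.src_mem x.left x.right x.right_mem x.pt x.pt_mem) p

theorem inv_apply {δ : Fin m → Derivation ℤ F F} (hδ : δ ∈ base d) (h : GL (Fin n) F)
    {g : GL (Fin m) F} (hg : g ∈ intGL δ) {v : Fin l → F} (hv : v ∈ W δ) :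
    τ (act g δ) h⁻¹ g⁻¹ (τ δ h g v) = v := by
  rw [hτ.apply_mul δ hδ h h⁻¹ g hg g⁻¹ (inv_mem_intGL hg) v hv, mul_inv_cancel, mul_inv_cancel,
    hτ.apply_one δ hδ v hv]

theorem exists_inverse_arrow {δ : Fin m → Derivation ℤ F F} (hδ : δ ∈ base d)
    (h : GL (Fin n) F) {g : GL (Fin m) F} (hg : g ∈ intGL δ) {v : Fin l → F} (hv : v ∈ W δ) :
    ∃ x : Arrow d n W, x.src = act g δ ∧ x.pt = τ δ h g v ∧ x.tgt = δ ∧ x.endpoint τ = v :=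
  ⟨⟨act g δ, act_mem_base hδ hg, h⁻¹, g⁻¹, inv_mem_intGL hg, τ δ h g v,
    hτ.mapsTo δ hδ h g hg v hv⟩, rfl, rfl, act_inv_act g δ, hτ.inv_apply hδ h hg hv⟩

theorem exists_arrow_to {δ δ₁ : Fin m → Derivation ℤ F F} (hδ : δ ∈ base d)
    (hδ₁ : δ₁ ∈ base d) {v : Fin l → F} (hv : v ∈ W δ₁) :
    ∃ x : Arrow d n W, x.src = δ ∧ x.tgt = δ₁ ∧ x.endpoint τ = v := by
  obtain ⟨g, hg, rfl⟩ := exists_act_eq hδ₁ hδ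
  obtain ⟨x, hsrc, -, htgt, hend⟩ := hτ.exists_inverse_arrow hδ₁ 1 hg hv
  exact ⟨x, hsrc, htgt, hend⟩

theorem isPrime_vanishingIdeal (hd : Commuting d) (hF : IsDiffClosed d)
    (hW : ∀ δ ∈ base d, @IsIrreducible _ (kolchin δ (Fin l)) (W δ)) :
    (vanishingIdeal d W).IsPrime := by
  refine ⟨(Ideal.ne_top_iff_one _).2 fun hone => ?_, fun {p q} hpq => ?_⟩
  · obtain ⟨v, hv⟩ := (hW d (self_mem_base d)).1
    exact one_ne_zero ((map_one (evalD d v)).symm.trans (hone d (self_mem_base d) v hv))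
  · have exists_arrow_of_notMem {p : DPoly (constants d) m (Fin l)}
        (hp : p ∉ vanishingIdeal d W) :
        ∃ x : Arrow d n W, x.src = d ∧ evalD x.tgt (x.endpoint τ) p ≠ 0 := by
      have hp' : ¬ ∀ δ ∈ base d, ∀ z ∈ W δ, evalD δ z p = 0 := hp
      push Not at hp'
      obtain ⟨δ, hδ, z, hz, hne⟩ := hp'
      obtain ⟨x, hx, rfl, rfl⟩ := hτ.exists_arrow_to (self_mem_base d) hδ hz
      exact ⟨x, hx, hne⟩
    by_contra! hpq'
    obtain ⟨x, hx, hxp⟩ := exists_arrow_of_notMem hpq'.1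
    obtain ⟨y, hy, hyq⟩ := exists_arrow_of_notMem hpq'.2
    obtain ⟨z, -, ⟨a, ha, hza⟩, b, hb, hzb⟩ := exists_arrow_hasValue hd hF hW
      (fun _ _ => subset_rfl) (fun δ _ => @subset_closure _ (kolchin δ _) _)
      (hx.trans hy.symm) (hτ.hasValue_targetPullback hd p x) hxp
      (hτ.hasValue_targetPullback hd q y) hyq
    have hz := hpq z.tgt z.tgt_mem _ (hτ.endpoint_mem z)
    rw [map_mul, (hτ.hasValue_targetPullback hd p z).unique z.src_mem z.coords_mem hza,
      (hτ.hasValue_targetPullback hd q z).unique z.src_mem z.coords_mem hzb] at hz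
    exact mul_ne_zero ha hb hz

theorem isField (hd : Commuting d) (hF : IsDiffClosed d)
    (hW : ∀ δ ∈ base d, @IsIrreducible _ (kolchin δ (Fin l)) (W δ)) :
    IsField (FunField d W) := by
  have := hτ.isPrime_vanishingIdeal hd hF hW
  have : IsDomain (CoordRing d W) :=
    inferInstanceAs (IsDomain (DPoly (constants d) m (Fin l) ⧸ vanishingIdeal d W))
  exact Field.toIsField (FractionRing (CoordRing d W))

end

end IsAlgebraicRep

end Groupoid

/-! ### Invariants -/

section Invariants

variable {F : Type u} [Field F] {l m n : ℕ} {d : Fin m → Derivation ℤ F F}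
  {W : (Fin m → Derivation ℤ F F) → Set (Fin l → F)}
  {τ : (Fin m → Derivation ℤ F F) → GL (Fin n) F → GL (Fin m) F → (Fin l → F) → (Fin l → F)}

theorem evalD_mul_eq_of_mem_invariants {f : FunField d W} (hf : f ∈ invariants W τ)
    {r s : DPoly (constants d) m (Fin l)} (hrs : f * toFun d W s = toFun d W r)
    (x : Arrow d n W) (hsrc : evalD x.src x.pt s ≠ 0)
    (htgt : evalD x.tgt (x.endpoint τ) s ≠ 0) :
    evalD x.tgt (x.endpoint τ) r * evalD x.src x.pt s =
      evalD x.src x.pt r * evalD x.tgt (x.endpoint τ) s := by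
  refine (div_eq_div_iff htgt hsrc).1 (hf x.src x.src_mem x.left x.right x.right_mem x.pt x.pt_mem
    _ _ ?_ ?_)
  · exact HasValue.of_mul_eq hrs (hasValue_toFun _ _ s) hsrc (hasValue_toFun _ _ r)
  · exact HasValue.of_mul_eq hrs (hasValue_toFun _ _ s) htgt (hasValue_toFun _ _ r)

theorem exists_evalD_groupCoeff_ne_zero (hd : Commuting d) (hF : IsDiffClosed d)
    (x : Arrow d n W) {S : DPoly (constants d) m (TripleIdx n m l)}
    (hS : evalD x.src x.coords S ≠ 0) : ∃ μ, evalD x.src x.pt (groupCoeff μ S) ≠ 0 := by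
  have hcomm := commuting_of_mem_base hd x.src_mem
  obtain ⟨μ, hμ⟩ := MvPolynomial.ne_zero_iff.1 (restrictToGroup_ne_zero hcomm
    (isDiffClosed_of_mem_base hd hF x.src_mem) x.right_mem hS)
  rw [coeff_restrictToGroup hcomm fun i c => base_const x.src_mem c i] at hμ
  exact ⟨μ, hμ⟩

namespace IsAlgebraicRep

section

variable {T : Fin l → FunField d (diamond n W)} (hτ : IsAlgebraicRep d W τ T)
include hτ

theorem mem_invariants_of_generic (hd : Commuting d) (hF : IsDiffClosed d)
    (hW : ∀ δ ∈ base d, @IsIrreducible _ (kolchin δ (Fin l)) (W δ))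
    {W₀ : (Fin m → Derivation ℤ F F) → Set (Fin l → F)} (hsub : ∀ δ ∈ base d, W₀ δ ⊆ W δ)
    (hdense : ∀ δ ∈ base d, W δ ⊆ @closure _ (kolchin δ (Fin l)) (W₀ δ)) {f e : FunField d W}
    (he : ∀ δ ∈ base d, ∃ u ∈ W₀ δ, ∃ c ≠ 0, HasValue e δ u c)
    (hf : ∀ x : Arrow d n W, x.pt ∈ W₀ x.src → (∃ c ≠ 0, HasValue e x.src x.pt c) →
      ∀ a b, HasValue f x.src x.pt a → HasValue f x.tgt (x.endpoint τ) b → b = a) :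
    f ∈ invariants W τ := by
  intro δ hδ h g hg v hv a b ⟨r, s, hrs, hs, har⟩ ⟨r', s', hrs', hs', hbr⟩
  by_contra hne
  let x : Arrow d n W := ⟨δ, hδ, h, g, hg, v, hv⟩
  let num (z : Arrow d n W) : F := evalD z.tgt (z.endpoint τ) r' * evalD z.src z.pt s -
    evalD z.src z.pt r * evalD z.tgt (z.endpoint τ) s'
  let den (z : Arrow d n W) : F := evalD z.src z.pt s * evalD z.tgt (z.endpoint τ) s'
  have hvalue (z : Arrow d n W) : HasValue
      ((targetPullback hd T r' * sourcePullback n W s -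
        sourcePullback n W r * targetPullback hd T s') *
        (sourcePullback n W s * targetPullback hd T s')) z.src z.coords (num z * den z) :=
    (((hτ.hasValue_targetPullback hd r' z).mul (hasValue_sourcePullback s z)).sub
      ((hasValue_sourcePullback r z).mul (hτ.hasValue_targetPullback hd s' z))).mul
      ((hasValue_sourcePullback s z).mul (hτ.hasValue_targetPullback hd s' z))
  have hden : den x ≠ 0 := mul_ne_zero hs.ne_zero hs'.ne_zero
  have hnum : num x = (b - a) * den x := by
    change evalD (act g δ) (τ δ h g v) r' * evalD δ v s -
      evalD δ v r * evalD (act g δ) (τ δ h g v) s' =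
        (b - a) * (evalD δ v s * evalD (act g δ) (τ δ h g v) s')
    rw [← har, ← hbr]
    ring
  obtain ⟨u, hu, c, hc, hec⟩ := he δ hδ
  obtain ⟨q, hq, hqe⟩ := exists_evalD_ne_zero_of_hasValue hec hc
  obtain ⟨z, hz, ⟨c₁, hc₁, hz₁⟩, c₂, hc₂, hz₂⟩ := exists_arrow_hasValue hd hF hW hsub hdense
    (x := x) (y := Arrow.id n hδ (hsub δ hδ hu)) rfl (hvalue x)
    (hnum ▸ mul_ne_zero (mul_ne_zero (sub_ne_zero.2 hne) hden) hden)
    (hasValue_sourcePullback q _) hq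
  rw [hz₁.unique z.src_mem z.coords_mem (hvalue z), mul_ne_zero_iff, mul_ne_zero_iff] at hc₁
  rw [hz₂.unique z.src_mem z.coords_mem (hasValue_sourcePullback q z)] at hc₂
  have hsrc := HasValue.of_mul_eq hrs (hasValue_toFun z.src z.pt s) hc₁.2.1 (hasValue_toFun _ _ r)
  have htgt := HasValue.of_mul_eq hrs' (hasValue_toFun z.tgt (z.endpoint τ) s') hc₁.2.2
    (hasValue_toFun _ _ r')
  exact hc₁.1 (sub_eq_zero.2 ((div_eq_div_iff hc₁.2.2 hc₁.2.1).1
    (hf z hz (hqe _ _ hc₂) _ _ hsrc htgt)))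

theorem exists_quotient_endpoint (hd : Commuting d) (r s : DPoly (constants d) m (Fin l))
    {x₀ : Arrow d n W} (hs : evalD x₀.tgt (x₀.endpoint τ) s ≠ 0) :
    ∃ R S : DPoly (constants d) m (TripleIdx n m l), evalD x₀.src x₀.coords S ≠ 0 ∧
      ∀ x : Arrow d n W, evalD x.src x.coords S ≠ 0 → evalD x.tgt (x.endpoint τ) s ≠ 0 ∧
        evalD x.tgt (x.endpoint τ) r * evalD x.src x.coords S =
          evalD x.tgt (x.endpoint τ) s * evalD x.src x.coords R := by
  have hval (p : DPoly (constants d) m (Fin l)) (q : DPoly (constants d) m (TripleIdx n m l))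
      (x : Arrow d n W) : HasValue (targetPullback hd T p * toFun d (diamond n W) q) x.src x.coords
        (evalD x.tgt (x.endpoint τ) p * evalD x.src x.coords q) :=
    (hτ.hasValue_targetPullback hd p x).mul (hasValue_toFun x.src x.coords q)
  obtain ⟨R, S, e, hS, hRS, hSe⟩ := exists_common_denominator
    (hτ.hasValue_targetPullback hd r x₀) (hτ.hasValue_targetPullback hd s x₀) hs
  refine ⟨R, S, hS, fun x hx => ⟨fun h0 => hx ?_, ?_⟩⟩
  · have hvalS := hval s e x
    rw [h0, zero_mul, ← hSe] at hvalS
    exact (hasValue_toFun x.src x.coords S).unique x.src_mem x.coords_mem hvalS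
  · exact (hval r S x).unique x.src_mem x.coords_mem (hRS ▸ hval s R x)

theorem restrictToGroup_eq_of_mem_invariants (hd : Commuting d) (hF : IsDiffClosed d)
    {f : FunField d W} (hf : f ∈ invariants W τ) {r s : DPoly (constants d) m (Fin l)}
    (hrs : f * toFun d W s = toFun d W r) {R S : DPoly (constants d) m (TripleIdx n m l)}
    (hRS : ∀ x : Arrow d n W, evalD x.src x.coords S ≠ 0 → evalD x.tgt (x.endpoint τ) s ≠ 0 ∧
      evalD x.tgt (x.endpoint τ) r * evalD x.src x.coords S =
        evalD x.tgt (x.endpoint τ) s * evalD x.src x.coords R)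
    (x : Arrow d n W) (hs : evalD x.src x.pt s ≠ 0)
    (hS : restrictToGroup x.tgt (x.endpoint τ) S ≠ 0) :
    MvPolynomial.C (evalD x.src x.pt r) * restrictToGroup x.tgt (x.endpoint τ) S =
      MvPolynomial.C (evalD x.src x.pt s) * restrictToGroup x.tgt (x.endpoint τ) R := by
  have hcomm := commuting_of_mem_base hd x.tgt_mem
  rw [← sub_eq_zero]
  by_contra hne
  obtain ⟨h, g, t, hg, hgt, ht⟩ := exists_group_point hcomm
    (isDiffClosed_of_mem_base hd hF x.tgt_mem) (mul_ne_zero hne hS)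
  rw [map_mul, map_sub, map_mul, map_mul, evalD_C, evalD_C,
    evalD_restrictToGroup hcomm, evalD_restrictToGroup hcomm, ← hgt,
    Algebra.algebraMap_self_apply, Algebra.algebraMap_self_apply, mul_ne_zero_iff] at ht
  let y : Arrow d n W := ⟨x.tgt, x.tgt_mem, h, g, hg, x.endpoint τ, hτ.endpoint_mem x⟩
  let xy : Arrow d n W := ⟨x.src, x.src_mem, x.left * h, x.right * g,
    (mul_mem_intGL_iff x.right_mem).2 hg, x.pt, x.pt_mem⟩
  have htgt : y.tgt = xy.tgt := act_act _ _ _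
  have hend : y.endpoint τ = xy.endpoint τ :=
    hτ.apply_mul x.src x.src_mem x.left h x.right x.right_mem g hg x.pt x.pt_mem
  obtain ⟨hsy, hy⟩ := hRS y ht.2
  rw [htgt, hend] at hsy hy
  have hinv := evalD_mul_eq_of_mem_invariants hf hrs xy hs hsy
  refine ht.1 (sub_eq_zero.2 (mul_right_cancel₀ hsy ?_))
  change evalD x.src x.pt r * evalD y.src y.coords S * evalD xy.tgt (xy.endpoint τ) s =
    evalD x.src x.pt s * evalD y.src y.coords R * evalD xy.tgt (xy.endpoint τ) s
  change _ * evalD x.src x.pt s = evalD x.src x.pt r * _ at hinv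
  linear_combination evalD x.src x.pt s * hy - evalD y.src y.coords S * hinv

theorem mul_evalD_groupCoeff_eq (hd : Commuting d) (hF : IsDiffClosed d)
    {f : FunField d W} (hf : f ∈ invariants W τ) {r s : DPoly (constants d) m (Fin l)}
    (hrs : f * toFun d W s = toFun d W r) {R S : DPoly (constants d) m (TripleIdx n m l)}
    (hRS : ∀ x : Arrow d n W, evalD x.src x.coords S ≠ 0 → evalD x.tgt (x.endpoint τ) s ≠ 0 ∧
      evalD x.tgt (x.endpoint τ) r * evalD x.src x.coords S =
        evalD x.tgt (x.endpoint τ) s * evalD x.src x.coords R)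
    (x : Arrow d n W) (hs : evalD x.src x.pt s ≠ 0)
    {μ : (GroupIdx n m × (Fin m → ℕ)) →₀ ℕ}
    (hμ : evalD x.tgt (x.endpoint τ) (groupCoeff μ S) ≠ 0) :
    evalD x.src x.pt r * evalD x.tgt (x.endpoint τ) (groupCoeff μ S) =
      evalD x.src x.pt s * evalD x.tgt (x.endpoint τ) (groupCoeff μ R) := by
  have hcoeff := coeff_restrictToGroup (n := n) (commuting_of_mem_base hd x.tgt_mem)
    (fun i c => base_const x.tgt_mem c i) μ (x.endpoint τ)
  rw [← hcoeff] at hμ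
  rw [← hcoeff, ← hcoeff, ← MvPolynomial.coeff_C_mul, ← MvPolynomial.coeff_C_mul,
    hτ.restrictToGroup_eq_of_mem_invariants hd hF hf hrs hRS x hs
      (MvPolynomial.ne_zero_iff.2 ⟨μ, hμ⟩)]

end

end IsAlgebraicRep

end Invariants

/-! ### Differential field extensions generated by a set -/

section Adjoin

variable {R K : Type*} [CommRing R] [CommRing K] [Algebra R K] {m : ℕ}
  {D : Fin m → Derivation ℤ K K}

theorem mem_diffFieldAdjoin {X : Set K} {f : K} :
    f ∈ diffFieldAdjoin R D X ↔ ∀ L : Subalgebra R K, X ⊆ L → (∀ i, ∀ a ∈ L, D i a ∈ L) →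
      (∀ a ∈ L, ∀ b, a * b = 1 → b ∈ L) → f ∈ L := by
  rw [diffFieldAdjoin, Algebra.mem_sInf]
  exact ⟨fun h L h1 h2 h3 => h L ⟨h1, h2, h3⟩, fun h L hL => h L hL.1 hL.2.1 hL.2.2⟩

theorem derivation_mem_diffFieldAdjoin {X : Set K} {f : K} (hf : f ∈ diffFieldAdjoin R D X)
    (i : Fin m) : D i f ∈ diffFieldAdjoin R D X :=
  mem_diffFieldAdjoin.2 fun L hX hD hinv => hD i _ (mem_diffFieldAdjoin.1 hf L hX hD hinv)

variable {κ : Type*} {w : κ → K}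

variable (R D w) in
/-- The subalgebra of the quotients of differential polynomials in `w`. -/
def evalDQuotients [IsDomain K] : Subalgebra R K where
  carrier := {f | ∃ r s : DPoly R m κ, evalD D w s ≠ 0 ∧ f * evalD D w s = evalD D w r}
  mul_mem' := by
    rintro f g ⟨r, s, hs, hf⟩ ⟨r', s', hs', hg⟩
    refine ⟨r * r', s * s', map_mul (evalD D w) s s' ▸ mul_ne_zero hs hs', ?_⟩
    rw [map_mul, map_mul, ← hf, ← hg, mul_mul_mul_comm]
  add_mem' := by
    rintro f g ⟨r, s, hs, hf⟩ ⟨r', s', hs', hg⟩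
    refine ⟨r * s' + r' * s, s * s', map_mul (evalD D w) s s' ▸ mul_ne_zero hs hs', ?_⟩
    rw [map_mul, map_add, map_mul, map_mul, ← hf, ← hg]
    ring
  algebraMap_mem' c := ⟨MvPolynomial.C c, 1, by simp, by simp⟩

theorem derivation_mem_evalDQuotients [IsDomain K] (hD : Commuting D)
    (hc : ∀ (c : R) i, D i (algebraMap R K c) = 0) (i : Fin m) {f : K}
    (hf : f ∈ evalDQuotients R D w) : D i f ∈ evalDQuotients R D w := by
  obtain ⟨r, s, hs, hrs⟩ := hf
  refine ⟨formalD R κ i r * s - r * formalD R κ i s, s * s,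
    map_mul (evalD D w) s s ▸ mul_ne_zero hs hs, ?_⟩
  have hquot := congrArg (D i) hrs
  rw [Derivation.leibniz, smul_eq_mul, smul_eq_mul] at hquot
  rw [map_sub, map_mul, map_mul, map_mul, evalD_formalD hD hc, evalD_formalD hD hc, ← hquot,
    ← hrs]
  ring

theorem mem_diffFieldAdjoin_range (hK : IsField K) (hD : Commuting D)
    (hc : ∀ (c : R) i, D i (algebraMap R K c) = 0) {f : K} :
    f ∈ diffFieldAdjoin R D (Set.range w) ↔
      ∃ r s : DPoly R m κ, evalD D w s ≠ 0 ∧ f * evalD D w s = evalD D w r := by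
  have := hK.isDomain
  refine ⟨fun hf => mem_diffFieldAdjoin.1 hf (evalDQuotients R D w) ?_
    (fun i a => derivation_mem_evalDQuotients hD hc i) ?_, ?_⟩
  · rintro _ ⟨k, rfl⟩
    exact ⟨MvPolynomial.X (k, 0), 1, by simp, by simp [jetOp_zero]⟩
  · rintro a ⟨r, s, hs, hrs⟩ b hab
    refine ⟨s, r, fun hr => ?_, ?_⟩
    · rw [hr] at hrs
      exact mul_ne_zero (left_ne_zero_of_mul (hab.trans_ne one_ne_zero)) hs hrs
    · rw [← hrs]
      linear_combination (evalD D w s) * hab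
  · rintro ⟨r, s, hs, hrs⟩
    refine mem_diffFieldAdjoin.2 fun L hX hDL hinv => ?_
    have hmem (p : DPoly R m κ) : evalD D w p ∈ L := evalD_mem hDL (fun k => hX ⟨k, rfl⟩) p
    obtain ⟨e, he⟩ := hK.mul_inv_cancel hs
    rw [← mul_one f, ← he, ← mul_assoc, hrs]
    exact L.mul_mem (hmem r) (hinv _ (hmem s) e he)

end Adjoin

/-! ### Moving frames -/

section MovingFrame

variable {F : Type u} [Field F] {l m n : ℕ} {d : Fin m → Derivation ℤ F F}
  {W : (Fin m → Derivation ℤ F F) → Set (Fin l → F)}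
  {τ : (Fin m → Derivation ℤ F F) → GL (Fin n) F → GL (Fin m) F → (Fin l → F) → (Fin l → F)}
  {T : Fin l → FunField d (diamond n W)}
  {W₀ : (Fin m → Derivation ℤ F F) → Set (Fin l → F)}
  {P₀ : (Fin m → Derivation ℤ F F) → (Fin l → F) → GL (Fin n) F}
  {P₁ : (Fin m → Derivation ℤ F F) → (Fin l → F) → GL (Fin m) F}
  {p₀ : Matrix (Fin n) (Fin n) (FunField d W)} {p₁ : Matrix (Fin m) (Fin m) (FunField d W)}

variable (d W τ W₀ P₀ P₁ p₀ p₁) in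
/-- `P = (P₀, P₁)` is an equivariant map from the invariant dense subfamily `W₀` of `W` to the
groups, with the entries of the matrices `p₀` and `p₁` over `C⟨W⟩` as its components. -/
structure IsMovingFrame : Prop where
  subset : ∀ δ ∈ base d, W₀ δ ⊆ W δ
  dense : ∀ δ ∈ base d, W δ ⊆ @closure _ (kolchin δ (Fin l)) (W₀ δ)
  mapsTo : ∀ δ ∈ base d, ∀ (h : GL (Fin n) F), ∀ g ∈ intGL δ, ∀ v ∈ W₀ δ,
    τ δ h g v ∈ W₀ (act g δ)
  hasValue_left : ∀ δ ∈ base d, ∀ v ∈ W₀ δ, ∀ i j, HasValue (p₀ i j) δ v (P₀ δ v i j)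
  hasValue_right : ∀ δ ∈ base d, ∀ v ∈ W₀ δ, ∀ i j, HasValue (p₁ i j) δ v (P₁ δ v i j)
  right_mem : ∀ δ ∈ base d, ∀ v ∈ W₀ δ, P₁ δ v ∈ intGL δ
  equivariant : ∀ δ ∈ base d, ∀ (h : GL (Fin n) F), ∀ g ∈ intGL δ, ∀ v ∈ W₀ δ,
    P₀ (act g δ) (τ δ h g v) = h⁻¹ * P₀ δ v ∧ P₁ (act g δ) (τ δ h g v) = g⁻¹ * P₁ δ v

variable (P₁) in
/-- The normal form of the system of derivations at a point. -/
def normalSystem (δ : Fin m → Derivation ℤ F F) (v : Fin l → F) : Fin m → Derivation ℤ F F :=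
  act (P₁ δ v) δ

variable (τ P₀ P₁) in
/-- The normal form `τ⟨P⟨v⟩; v⟩` of a point `v`. -/
def normalPoint (δ : Fin m → Derivation ℤ F F) (v : Fin l → F) : Fin l → F :=
  τ δ (P₀ δ v) (P₁ δ v) v

namespace IsMovingFrame

section

variable (hP : IsMovingFrame d W τ W₀ P₀ P₁ p₀ p₁)
include hP

theorem nonempty {δ : Fin m → Derivation ℤ F F} (hδ : δ ∈ base d) (hW : (W δ).Nonempty) :
    (W₀ δ).Nonempty := by
  let := kolchin δ (Fin l)
  exact closure_nonempty_iff.1 (hW.mono (hP.dense δ hδ))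

theorem isUnit_right : IsUnit p₁ := by
  rw [Matrix.isUnit_iff_isUnit_det]
  exact isUnit_of_forall_hasValue hP.dense hP.subset fun δ hδ v hv =>
    ⟨_, ((Matrix.isUnit_iff_isUnit_det _).1 (P₁ δ v).isUnit).ne_zero,
      HasValue.det (hP.hasValue_right δ hδ v hv)⟩

theorem commuting_combo (hd : Commuting d) (hK : IsField (FunField d W)) :
    Commuting (combo p₁⁻¹ (funD hd W)) := by
  let := hK.toField
  obtain ⟨g, hg⟩ := hP.isUnit_right
  have hint : g ∈ intGL (funD hd W) := by
    intro i j k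
    rw [hg]
    refine eq_of_forall_hasValue hP.dense hP.subset fun δ hδ v hv => ⟨δ i (P₁ δ v j k),
      (hP.hasValue_right δ hδ v hv j k).derivation hd hδ i, ?_⟩
    rw [hP.right_mem δ hδ v hv i j k]
    exact (hP.hasValue_right δ hδ v hv i k).derivation hd hδ j
  have hact := commuting_act (commuting_funD hd W) hint
  rw [act, Matrix.coe_units_inv, hg] at hact
  exact hact

theorem hasValue_evalD_triple (hd : Commuting d) {δ : Fin m → Derivation ℤ F F}
    (hδ : δ ∈ base d) {v : Fin l → F} (hv : v ∈ W₀ δ)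
    (p : DPoly (constants d) m (TripleIdx n m l)) :
    HasValue (evalD (funD hd W) (triple p₀ p₁ (coord d W)) p) δ v
      (evalD δ (triple (P₀ δ v).val (P₁ δ v).val v) p) := by
  refine HasValue.evalD (fun i f a ha => ha.derivation hd hδ i) ?_ p
  rintro (⟨i, j⟩ | ⟨i, j⟩ | k)
  · exact hP.hasValue_left δ hδ v hv i j
  · exact hP.hasValue_right δ hδ v hv i j
  · exact hasValue_coord δ v k

theorem evalD_triple_eq_of_toFun_eq (hd : Commuting d)
    {p q : DPoly (constants d) m (TripleIdx n m l)}
    (hpq : toFun d (diamond n W) p = toFun d (diamond n W) q) :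
    evalD (funD hd W) (triple p₀ p₁ (coord d W)) p =
      evalD (funD hd W) (triple p₀ p₁ (coord d W)) q := by
  refine eq_of_forall_hasValue hP.dense hP.subset fun δ hδ v hv =>
    ⟨_, hP.hasValue_evalD_triple hd hδ hv p, ?_⟩
  rw [evalD_eq_of_toFun_eq hpq hδ
    ⟨P₀ δ v, P₁ δ v, v, hP.right_mem δ hδ v hv, hP.subset δ hδ hv, rfl⟩]
  exact hP.hasValue_evalD_triple hd hδ hv q

theorem exists_hasValue_triple (hd : Commuting d) (hK : IsField (FunField d W))
    (hW : (W d).Nonempty) {f : FunField d (diamond n W)}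
    {b : (Fin m → Derivation ℤ F F) → (Fin l → F) → F}
    (hf : ∀ δ ∈ base d, ∀ v ∈ W₀ δ, HasValue f δ (triple (P₀ δ v).val (P₁ δ v).val v) (b δ v)) :
    ∃ e : FunField d W, HasValue f (funD hd W) (triple p₀ p₁ (coord d W)) e ∧
      ∀ δ ∈ base d, ∀ v ∈ W₀ δ, HasValue e δ v (b δ v) := by
  have hval {δ} (hδ : δ ∈ base d) {v} (hv : v ∈ W₀ δ) := hP.hasValue_evalD_triple hd hδ hv
  have hd₀ := self_mem_base d
  obtain ⟨v₀, hv₀⟩ := hP.nonempty hd₀ hW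
  obtain ⟨r, s, hrs, hs, -⟩ := hf d hd₀ v₀ hv₀
  have hs0 : evalD (funD hd W) (triple p₀ p₁ (coord d W)) s ≠ 0 :=
    (hval hd₀ hv₀ s).ne_zero hd₀ (hP.subset d hd₀ hv₀) hs.ne_zero
  obtain ⟨s', hs'⟩ := hK.mul_inv_cancel hs0
  refine ⟨s' * evalD (funD hd W) (triple p₀ p₁ (coord d W)) r,
    ⟨r, s, hrs, IsUnit.of_mul_eq_one s' hs', ?_⟩, fun δ hδ v hv => ?_⟩
  · linear_combination (evalD (funD hd W) (triple p₀ p₁ (coord d W)) r) * hs'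
  · obtain ⟨r₁, s₁, hrs₁, hs₁, hb⟩ := hf δ hδ v hv
    have hcross := hP.evalD_triple_eq_of_toFun_eq hd (p := r * s₁) (q := r₁ * s)
      (by rw [toFun_mul, toFun_mul, ← hrs, ← hrs₁, mul_right_comm])
    rw [map_mul, map_mul] at hcross
    rw [eq_div_of_mul_eq hs₁.ne_zero hb]
    refine HasValue.of_mul_eq ?_ (hval hδ hv s₁) hs₁.ne_zero (hval hδ hv r₁)
    linear_combination s' * hcross + (evalD (funD hd W) (triple p₀ p₁ (coord d W)) r₁) * hs'

theorem exists_generators (hd : Commuting d) (hK : IsField (FunField d W))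
    (hW : (W d).Nonempty) (hτ : IsAlgebraicRep d W τ T) :
    ∃ w : Fin l → FunField d W,
      (∀ k, HasValue (T k) (funD hd W) (triple p₀ p₁ (coord d W)) (w k)) ∧
      ∀ δ ∈ base d, ∀ v ∈ W₀ δ, ∀ k, HasValue (w k) δ v (normalPoint τ P₀ P₁ δ v k) := by
  choose w hwT hw using fun k => hP.exists_hasValue_triple hd hK hW
    (b := fun δ v => normalPoint τ P₀ P₁ δ v k) fun δ hδ v hv =>
      hτ.hasValue δ hδ _ _ (hP.right_mem δ hδ v hv) v (hP.subset δ hδ hv) k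
  exact ⟨w, hwT, fun δ hδ v hv k => hw k δ hδ v hv⟩

theorem normalSystem_endpoint (x : Arrow d n W) (hx : x.pt ∈ W₀ x.src) :
    normalSystem P₁ x.tgt (x.endpoint τ) = normalSystem P₁ x.src x.pt := by
  rw [normalSystem, Arrow.tgt, Arrow.endpoint,
    (hP.equivariant x.src x.src_mem x.left x.right x.right_mem x.pt hx).2, act_act,
    mul_inv_cancel_left, normalSystem]

theorem normalPoint_endpoint (hτ : IsAlgebraicRep d W τ T) (x : Arrow d n W)
    (hx : x.pt ∈ W₀ x.src) :
    normalPoint τ P₀ P₁ x.tgt (x.endpoint τ) = normalPoint τ P₀ P₁ x.src x.pt := by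
  obtain ⟨hleft, hright⟩ : P₀ x.tgt (x.endpoint τ) = x.left⁻¹ * P₀ x.src x.pt ∧
      P₁ x.tgt (x.endpoint τ) = x.right⁻¹ * P₁ x.src x.pt :=
    hP.equivariant x.src x.src_mem x.left x.right x.right_mem x.pt hx
  calc normalPoint τ P₀ P₁ x.tgt (x.endpoint τ)
      = τ x.src (x.left * P₀ x.tgt (x.endpoint τ)) (x.right * P₁ x.tgt (x.endpoint τ)) x.pt :=
        hτ.apply_mul x.src x.src_mem x.left _ x.right x.right_mem _
          (hP.right_mem x.tgt x.tgt_mem _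
            (hP.mapsTo x.src x.src_mem x.left x.right x.right_mem x.pt hx)) x.pt x.pt_mem
    _ = normalPoint τ P₀ P₁ x.src x.pt := by
        rw [hleft, hright, mul_inv_cancel_left, mul_inv_cancel_left, normalPoint]

end

section

variable (hP : IsMovingFrame d W τ W₀ P₀ P₁ p₀ p₁) {w : Fin l → FunField d W}
  (hw : ∀ δ ∈ base d, ∀ v ∈ W₀ δ, ∀ k, HasValue (w k) δ v (normalPoint τ P₀ P₁ δ v k))
include hP hw

theorem hasValue_evalD_generators (hd : Commuting d) {δ : Fin m → Derivation ℤ F F}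
    (hδ : δ ∈ base d) {v : Fin l → F} (hv : v ∈ W₀ δ) (q : DPoly (constants d) m (Fin l)) :
    HasValue (evalD (combo p₁⁻¹ (funD hd W)) w q) δ v
      (evalD (normalSystem P₁ δ v) (normalPoint τ P₀ P₁ δ v) q) :=
  HasValue.evalD
    (fun i _ _ ha => ha.combo hd hδ hP.isUnit_right (hP.hasValue_right δ hδ v hv) i)
    (hw δ hδ v hv) q

theorem exists_evalD_normal_ne_zero (hd : Commuting d) (hτ : IsAlgebraicRep d W τ T)
    {q : DPoly (constants d) m (Fin l)} (hq : evalD (combo p₁⁻¹ (funD hd W)) w q ≠ 0)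
    {δ : Fin m → Derivation ℤ F F} (hδ : δ ∈ base d) :
    ∃ u ∈ W₀ δ, evalD (normalSystem P₁ δ u) (normalPoint τ P₀ P₁ δ u) q ≠ 0 := by
  by_contra! hzero
  refine hq (eq_zero_of_forall_hasValue hP.dense fun δ₁ hδ₁ v hv a ha => ?_)
  obtain ⟨g, hg, rfl⟩ := exists_act_eq hδ₁ hδ
  let x : Arrow d n W := ⟨δ₁, hδ₁, 1, g, hg, v, hP.subset δ₁ hδ₁ hv⟩
  rw [ha.unique hδ₁ x.pt_mem (hP.hasValue_evalD_generators hw hd hδ₁ hv q),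
    ← hP.normalSystem_endpoint x hv, ← hP.normalPoint_endpoint hτ x hv]
  exact hzero _ (hP.mapsTo δ₁ hδ₁ 1 g hg v hv)

theorem mem_invariants (hd : Commuting d) (hF : IsDiffClosed d)
    (hW : ∀ δ ∈ base d, @IsIrreducible _ (kolchin δ (Fin l)) (W δ))
    (hτ : IsAlgebraicRep d W τ T) {f : FunField d W} {p q : DPoly (constants d) m (Fin l)}
    (hq : evalD (combo p₁⁻¹ (funD hd W)) w q ≠ 0)
    (hf : f * evalD (combo p₁⁻¹ (funD hd W)) w q = evalD (combo p₁⁻¹ (funD hd W)) w p) :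
    f ∈ invariants W τ := by
  have hval {δ} (hδ : δ ∈ base d) {v} (hv : v ∈ W₀ δ) :=
    hP.hasValue_evalD_generators hw hd hδ hv
  refine hτ.mem_invariants_of_generic hd hF hW hP.subset hP.dense
    (e := evalD (combo p₁⁻¹ (funD hd W)) w q) (fun δ hδ => ?_) ?_
  · obtain ⟨u, hu, hu0⟩ := hP.exists_evalD_normal_ne_zero hw hd hτ hq hδ
    exact ⟨u, hu, _, hu0, hval hδ hu q⟩
  · rintro x hx ⟨c, hc, hqc⟩ a b ha hb
    have hend : x.endpoint τ ∈ W₀ x.tgt :=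
      hP.mapsTo x.src x.src_mem x.left x.right x.right_mem x.pt hx
    have hsrc := (ha.mul (hval x.src_mem hx q)).unique x.src_mem x.pt_mem
      (hf ▸ hval x.src_mem hx p)
    have htgt := (hb.mul (hval x.tgt_mem hend q)).unique x.tgt_mem (hP.subset _ x.tgt_mem hend)
      (hf ▸ hval x.tgt_mem hend p)
    rw [hP.normalSystem_endpoint x hx, hP.normalPoint_endpoint hτ x hx, ← hsrc] at htgt
    exact mul_right_cancel₀ (((hval x.src_mem hx q).unique x.src_mem x.pt_mem hqc).trans_ne hc)
      htgt

theorem toFun_mul_evalD_eq (hd : Commuting d) (hK : IsField (FunField d W))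
    {r s A B : DPoly (constants d) m (Fin l)}
    (h : ∀ δ ∈ base d, ∀ v ∈ W₀ δ, evalD δ v s ≠ 0 →
      evalD (normalSystem P₁ δ v) (normalPoint τ P₀ P₁ δ v) B ≠ 0 →
        evalD δ v r * evalD (normalSystem P₁ δ v) (normalPoint τ P₀ P₁ δ v) B =
          evalD δ v s * evalD (normalSystem P₁ δ v) (normalPoint τ P₀ P₁ δ v) A)
    (hs : toFun d W s ≠ 0) (hB : evalD (combo p₁⁻¹ (funD hd W)) w B ≠ 0) :
    toFun d W r * evalD (combo p₁⁻¹ (funD hd W)) w B =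
      toFun d W s * evalD (combo p₁⁻¹ (funD hd W)) w A := by
  have := hK.isDomain
  refine mul_right_cancel₀ (mul_ne_zero hs hB)
    (eq_of_forall_hasValue hP.dense hP.subset fun δ hδ v hv => ?_)
  have hval := hP.hasValue_evalD_generators hw hd hδ hv
  have hden := (hasValue_toFun δ v s).mul (hval B)
  refine ⟨_, ((hasValue_toFun δ v r).mul (hval B)).mul hden, ?_⟩
  convert ((hasValue_toFun δ v s).mul (hval A)).mul hden using 1
  by_cases h0 : evalD δ v s * evalD (normalSystem P₁ δ v) (normalPoint τ P₀ P₁ δ v) B = 0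
  · rw [h0, mul_zero, mul_zero]
  · rw [h δ hδ v hv (left_ne_zero_of_mul h0) (right_ne_zero_of_mul h0)]

theorem exists_of_mem_invariants (hd : Commuting d) (hF : IsDiffClosed d)
    (hK : IsField (FunField d W)) (hτ : IsAlgebraicRep d W τ T) {f : FunField d W}
    (hf : f ∈ invariants W τ) : ∃ p q : DPoly (constants d) m (Fin l),
      evalD (combo p₁⁻¹ (funD hd W)) w q ≠ 0 ∧
        f * evalD (combo p₁⁻¹ (funD hd W)) w q = evalD (combo p₁⁻¹ (funD hd W)) w p := by
  have := hK.isDomain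
  obtain ⟨r, s, hrs, hs⟩ := exists_toFun_eq f
  obtain ⟨δ₀, hδ₀, v₀, hv₀, hs₀⟩ : ∃ δ ∈ base d, ∃ v ∈ W₀ δ, evalD δ v s ≠ 0 := by
    by_contra! hzero
    exact hs.ne_zero (toFun_eq_zero_of_dense hP.dense hzero)
  obtain ⟨x₀, hsrc, hpt, htgt, hend⟩ := hτ.exists_inverse_arrow hδ₀ (P₀ δ₀ v₀)
    (hP.right_mem δ₀ hδ₀ v₀ hv₀) (hP.subset δ₀ hδ₀ hv₀)
  rw [← htgt, ← hend] at hs₀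
  obtain ⟨R, S, hS₀, hRS⟩ := hτ.exists_quotient_endpoint hd r s hs₀
  obtain ⟨μ, hμ⟩ := exists_evalD_groupCoeff_ne_zero hd hF x₀ hS₀
  rw [hsrc, hpt] at hμ
  have hE : evalD (combo p₁⁻¹ (funD hd W)) w (groupCoeff μ S) ≠ 0 :=
    (hP.hasValue_evalD_generators hw hd hδ₀ hv₀ _).ne_zero hδ₀ (hP.subset δ₀ hδ₀ hv₀) hμ
  refine ⟨groupCoeff μ R, groupCoeff μ S, hE, mul_right_cancel₀ hs.ne_zero ?_⟩
  have hcross := hP.toFun_mul_evalD_eq hw hd hK (fun δ hδ v hv hsv hSv =>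
    hτ.mul_evalD_groupCoeff_eq hd hF hf hrs hRS ⟨δ, hδ, P₀ δ v, P₁ δ v, hP.right_mem δ hδ v hv,
      v, hP.subset δ hδ hv⟩ hsv hSv) hs.ne_zero hE
  linear_combination evalD (combo p₁⁻¹ (funD hd W)) w (groupCoeff μ S) * hrs + hcross

end

end IsMovingFrame

end MovingFrame

end DiffInv

end

theorem theorem2p4_general {F : Type u} [Field F] {l m n : ℕ}
    {d : Fin m → Derivation ℤ F F} (hd : DiffInv.Commuting d) (hF : DiffInv.IsDiffClosed d)
    {W : (Fin m → Derivation ℤ F F) → Set (Fin l → F)}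
    (hW : ∀ δ ∈ DiffInv.base d, @IsIrreducible _ (DiffInv.kolchin δ (Fin l)) (W δ))
    {τ : (Fin m → Derivation ℤ F F) → GL (Fin n) F → GL (Fin m) F → (Fin l → F) → (Fin l → F)}
    {T : Fin l → DiffInv.FunField d (DiffInv.diamond n W)}
    (hτ : DiffInv.IsAlgebraicRep d W τ T)
    {W₀ : (Fin m → Derivation ℤ F F) → Set (Fin l → F)}
    {P₀ : (Fin m → Derivation ℤ F F) → (Fin l → F) → GL (Fin n) F}
    {P₁ : (Fin m → Derivation ℤ F F) → (Fin l → F) → GL (Fin m) F}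
    {p₀ : Matrix (Fin n) (Fin n) (DiffInv.FunField d W)}
    {p₁ : Matrix (Fin m) (Fin m) (DiffInv.FunField d W)}
    (hP : DiffInv.IsMovingFrame d W τ W₀ P₀ P₁ p₀ p₁) :
    IsField (DiffInv.FunField d W) ∧ IsUnit p₁ ∧
    DiffInv.Commuting (DiffInv.combo p₁⁻¹ (DiffInv.funD hd W)) ∧
    (∀ i, ∀ f ∈ DiffInv.invariants (d := d) W τ,
      DiffInv.combo p₁⁻¹ (DiffInv.funD hd W) i f ∈ DiffInv.invariants (d := d) W τ) ∧
    ∃ w : Fin l → DiffInv.FunField d W,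
      (∀ k, DiffInv.HasValue (T k) (DiffInv.funD hd W)
        (DiffInv.triple p₀ p₁ (DiffInv.coord d W)) (w k)) ∧
      (DiffInv.diffFieldAdjoin (DiffInv.constants d)
        (DiffInv.combo p₁⁻¹ (DiffInv.funD hd W)) (Set.range w) : Set (DiffInv.FunField d W)) =
        DiffInv.invariants (d := d) W τ := by
  have hK : IsField (DiffInv.FunField d W) := hτ.isField hd hF hW
  have hcomm := hP.commuting_combo hd hK
  obtain ⟨w, hwT, hw⟩ :=
    hP.exists_generators hd hK (hW d (DiffInv.self_mem_base d)).1 hτ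
  have hmem (f : DiffInv.FunField d W) :
      f ∈ DiffInv.diffFieldAdjoin (DiffInv.constants d)
        (DiffInv.combo p₁⁻¹ (DiffInv.funD hd W)) (Set.range w) ↔ f ∈ DiffInv.invariants W τ :=
    (DiffInv.mem_diffFieldAdjoin_range hK hcomm
      fun c i => DiffInv.combo_funD_algebraMap hd p₁⁻¹ i c).trans
      ⟨fun ⟨_, _, hq, hf⟩ => hP.mem_invariants hw hd hF hW hτ hq hf,
        hP.exists_of_mem_invariants hw hd hF hK hτ⟩
  exact ⟨hK, hP.isUnit_right, hcomm, fun i f hf =>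
    (hmem _).1 (DiffInv.derivation_mem_diffFieldAdjoin ((hmem f).2 hf) i), w, hwT, Set.ext hmem⟩

theorem theorem2p4 {F : Type u} [Field F] [CharZero F] {l m n : ℕ}
    -- a differentially closed field whose derivations are linearly independent over `F`
    (d : Fin m → Derivation ℤ F F) (hd : DiffInv.Commuting d)
    (hind : LinearIndependent F d) (hF : DiffInv.IsDiffClosed d)
    -- the family `W` of closed irreducible sets
    (W : (Fin m → Derivation ℤ F F) → Set (Fin l → F))
    (hWclosed : ∀ δ ∈ DiffInv.base d, @IsClosed _ (DiffInv.kolchin δ (Fin l)) (W δ))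
    (hWirred : ∀ δ ∈ DiffInv.base d, @IsIrreducible _ (DiffInv.kolchin δ (Fin l)) (W δ))
    -- the algebraic representation `τ` on `W`; the differential rational functions `T k` are its
    -- components
    (τ : (Fin m → Derivation ℤ F F) → GL (Fin n) F → GL (Fin m) F → (Fin l → F) → (Fin l → F))
    (T : Fin l → DiffInv.FunField d (DiffInv.diamond n W))
    (hT : ∀ δ ∈ DiffInv.base d, ∀ (h : GL (Fin n) F), ∀ g ∈ DiffInv.intGL δ, ∀ v ∈ W δ, ∀ k,
      DiffInv.HasValue (T k) δ (DiffInv.triple h.val g.val v) (τ δ h g v k))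
    (hτW : ∀ δ ∈ DiffInv.base d, ∀ (h : GL (Fin n) F), ∀ g ∈ DiffInv.intGL δ, ∀ v ∈ W δ,
      τ δ h g v ∈ W (DiffInv.act g δ))
    (hτone : ∀ δ ∈ DiffInv.base d, ∀ v ∈ W δ, τ δ 1 1 v = v)
    (hτmul : ∀ δ ∈ DiffInv.base d, ∀ (h h₁ : GL (Fin n) F), ∀ g ∈ DiffInv.intGL δ,
      ∀ g₁ ∈ DiffInv.intGL (DiffInv.act g δ), ∀ v ∈ W δ,
      τ (DiffInv.act g δ) h₁ g₁ (τ δ h g v) = τ δ (h * h₁) (g * g₁) v)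
    -- the invariant dense subfamily `W₀`
    (W₀ : (Fin m → Derivation ℤ F F) → Set (Fin l → F))
    (hW₀W : ∀ δ ∈ DiffInv.base d, W₀ δ ⊆ W δ)
    (hW₀dense : ∀ δ ∈ DiffInv.base d, W δ ⊆ @closure _ (DiffInv.kolchin δ (Fin l)) (W₀ δ))
    (hW₀inv : ∀ δ ∈ DiffInv.base d, ∀ (h : GL (Fin n) F), ∀ g ∈ DiffInv.intGL δ, ∀ v ∈ W₀ δ,
      τ δ h g v ∈ W₀ (DiffInv.act g δ))
    -- the equivariant map `P = (P₀, P₁)` on `W₀`; the entries of `p₀`, `p₁` are its components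
    (P₀ : (Fin m → Derivation ℤ F F) → (Fin l → F) → GL (Fin n) F)
    (P₁ : (Fin m → Derivation ℤ F F) → (Fin l → F) → GL (Fin m) F)
    (p₀ : Matrix (Fin n) (Fin n) (DiffInv.FunField d W))
    (p₁ : Matrix (Fin m) (Fin m) (DiffInv.FunField d W))
    (hp₀ : ∀ δ ∈ DiffInv.base d, ∀ v ∈ W₀ δ, ∀ i j,
      DiffInv.HasValue (p₀ i j) δ v (P₀ δ v i j))
    (hp₁ : ∀ δ ∈ DiffInv.base d, ∀ v ∈ W₀ δ, ∀ i j,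
      DiffInv.HasValue (p₁ i j) δ v (P₁ δ v i j))
    (hP₁ : ∀ δ ∈ DiffInv.base d, ∀ v ∈ W₀ δ, P₁ δ v ∈ DiffInv.intGL δ)
    (hP : ∀ δ ∈ DiffInv.base d, ∀ (h : GL (Fin n) F), ∀ g ∈ DiffInv.intGL δ, ∀ v ∈ W₀ δ,
      P₀ (DiffInv.act g δ) (τ δ h g v) = h⁻¹ * P₀ δ v ∧
      P₁ (DiffInv.act g δ) (τ δ h g v) = g⁻¹ * P₁ δ v) :
    -- `C⟨W⟩` is a field and `P₁⟨x⟩` is invertible over it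
    IsField (DiffInv.FunField d W) ∧ IsUnit p₁ ∧
    -- the members of `δ = P₁⟨x⟩⁻¹ ∂` commute
    DiffInv.Commuting (DiffInv.combo p₁⁻¹ (DiffInv.funD hd W)) ∧
    -- the field of invariants is closed under `δ`
    (∀ i, ∀ f ∈ DiffInv.invariants (d := d) W τ,
      DiffInv.combo p₁⁻¹ (DiffInv.funD hd W) i f ∈ DiffInv.invariants (d := d) W τ) ∧
    -- `w = τ⟨P⟨x⟩; x⟩` is defined and generates it over `C` as a `δ`-differential field
    ∃ w : Fin l → DiffInv.FunField d W,
      (∀ k, DiffInv.HasValue (T k) (DiffInv.funD hd W)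
        (DiffInv.triple p₀ p₁ (DiffInv.coord d W)) (w k)) ∧
      (DiffInv.diffFieldAdjoin (DiffInv.constants d)
        (DiffInv.combo p₁⁻¹ (DiffInv.funD hd W)) (Set.range w) : Set (DiffInv.FunField d W)) =
        DiffInv.invariants (d := d) W τ :=
  theorem2p4_general hd hF hWirred ⟨hT, hτW, hτone, hτmul⟩
    ⟨hW₀W, hW₀dense, hW₀inv, hp₀, hp₁, hP₁, hP⟩
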